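/- **Setting.** Let $X\in\mathbb R^{m\times n}$ with columns $x_1,\dots,x_n$, $1\le m\le n$, $\operatorname{rank}X=m$. For $\mathcal S\subseteq\{1,\dots,n\}$ let $X_{\mathcal S}$ be the submatrix of the columns in $\mathcal S$, $\mathrm{Vol}(X_{\mathcal S})=\sqrt{\det(X_{\mathcal S}X_{\mathcal S}^T)}$, and, if $\operatorname{rank}X_{\mathcal S}=m$, $Y=(X_{\mathcal S}X_{\mathcal S}^T)^{-1}$ and $l_j=x_j^TYx_j$. *Dominant-split* with starting set $\mathcal S$ ($|\mathcal S|=k\ge m$, $\operatorname{rank} X_{\mathcal S}=m$) and parameter $c\ge 1$: optionally replace $X$ by the orthogonal factor of its LQ decomposition; compute $Y$ and $l$. Repeat: choose $s\in\arg\max_{j\notin\mathcal S}l_j$; compute $l'_j=l_j-(x_s^TYx_j)^2/(1+l_s)$ and $Y'=Y-Yx_sx_s^TY/(1+l_s)$; choose $r\in\arg\min_{j\in\mathcal S}l'_j$; stop if $(1+l_s)(1-l'_r)\le c^2$; otherwise replace $\mathcal S$ by $\mathcal S\cup\{s\}\setminus\{r\}$, $l_j$ by $l'_j+(x_r^TY'x_j)^2/(1-l'_r)$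 and $Y$ by $Y'+Y'x_rx_r^TY'/(1-l'_r)$. (It also stops if $\mathcal S=\{1,\dots,n\}$.) *Dominant algorithm* with the same input: maintain $X_{\mathcal S}^\dagger X$ and $l$ by rank-one updates. In each iteration find an exchange $s\notin\mathcal S$, $r\in\mathcal S$ that maximizes $\mathrm{Vol}(X_{\mathcal S\cup\{s\}\setminus\{r\}})$, carry it out if it increases the volume by a factor greater than $c$, and stop otherwise (or if there is no exchange). *Advanced initialization* for $m\le k\le n$: let $\mathcal I$ be the set of the $m$ pivots of column pivoted QR of $X$. Take any $\mathcal S\supseteq\mathcal I$ with $|\mathcal S|=\min(2m-1,n)$, and run Dominant-split from it with parameter $\sqrt{\min(e,\,1+2m/(2m-1))}$. Then, until $|\mathcal S|=k$, repeatedly remove a column $r\in\arg\min_{j\in\mathcal S}l_j$ if $|\mathcal S|>k$, or append a column $s\in\arg\max_{j\notin\mathcal S}l_j$ if $|\mathcal S|<k$, updating $Y$ and $l$. All arithmetic is exact; every arithmetic operation, square root, comparison and load of a constant counts as one operation. Ties may be resolved in any way. **Theorem.** There is an absolute constant $K>0$ such that the following holds for all $1\le m\le k\le n$, all $X\in\mathbb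 R^{m\times n}$ of rank $m$, and every set $\mathcal S$ produced by the advanced initialization. 1. If $k\le 2m-1$, then $\mathrm{Vol}(X_{\mathcal S})\ge \dfrac{3^{-m/2}}{\sqrt{\binom{2m-1}{m}}}\max_{|\mathcal T|=k}\mathrm{Vol}(X_{\mathcal T})$; if $k\ge 2m-1$, then $\mathrm{Vol}(X_{\mathcal S})\ge 6^{-m/2}\max_{|\mathcal T|=k}\mathrm{Vol}(X_{\mathcal T})$. 2. For every $c>1$, Dominant-split called with $\mathcal S$ and $c$ terminates after at most $K\,nm^2\,(1+1/\log c)$ operations in total. 3. For every $c>1$, the Dominant algorithm called with $\mathcal S$ and $c$ terminates after at most $K\,nkm\,(1+1/\log c)$ operations in total. In particular, for $c$ in any bounded range $(1,c_0]$ the costs are $O(nm^2/\log c)$ and $O(nkm/\log c)$, with constants that depend only on $c_0$. -/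

import Mathlib

namespace ColumnExchange

/-! ### Straight-line arithmetic with an operation count

A `Prog V α` is a computation on numbers of type `V` with a result of type `α`.  All algorithms below
are written for an arbitrary type `V`, so the instructions listed here are the only way in which they
can produce or inspect numbers.  Indices and index sets are handled by the host language for free. -/

inductive Prog (V α : Type) : Type
  | ret (a : α)
  | const (z : ℤ) (next : V → Prog V α)
  | add (x y : V) (next : V → Prog V α)
  | sub (x y : V) (next : V → Prog V α)
  | mul (x y : V) (next : V → Prog V α)
  | div (x y : V) (next : V → Prog V α)
  | sqrt (x : V) (next : V → Prog V α)
  | le (x y : V) (next : Bool → Prog V α)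

namespace Prog

def bind {V α β : Type} : Prog V α → (α → Prog V β) → Prog V β
  | ret a, f => f a
  | const z k, f => const z fun v => (k v).bind f
  | add x y k, f => add x y fun v => (k v).bind f
  | sub x y k, f => sub x y fun v => (k v).bind f
  | mul x y k, f => mul x y fun v => (k v).bind f
  | div x y k, f => div x y fun v => (k v).bind f
  | sqrt x k, f => sqrt x fun v => (k v).bind f
  | le x y k, f => le x y fun b => (k b).bind f

instance {V : Type} : Monad (Prog V) where
  pure := ret
  bind := bind

/-- The result of a computation in exact real arithmetic. -/
noncomputable def eval {α : Type} : Prog ℝ α → α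
  | ret a => a
  | const z k => (k (z : ℝ)).eval
  | add x y k => (k (x + y)).eval
  | sub x y k => (k (x - y)).eval
  | mul x y k => (k (x * y)).eval
  | div x y k => (k (x / y)).eval
  | sqrt x k => (k (Real.sqrt x)).eval
  | le x y k => (k (decide (x ≤ y))).eval

/-- The number of instructions carried out in exact real arithmetic: every addition, subtraction,
multiplication, division, square root, comparison and load of a constant counts one. -/
noncomputable def cost {α : Type} : Prog ℝ α → ℕ
  | ret _ => 0
  | const z k => 1 + (k (z : ℝ)).cost
  | add x y k => 1 + (k (x + y)).cost
  | sub x y k => 1 + (k (x - y)).cost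
  | mul x y k => 1 + (k (x * y)).cost
  | div x y k => 1 + (k (x / y)).cost
  | sqrt x k => 1 + (k (Real.sqrt x)).cost
  | le x y k => 1 + (k (decide (x ≤ y))).cost

end Prog

section Instructions

variable {V : Type}

def constP (z : ℤ) : Prog V V := Prog.const z Prog.ret
def addP (x y : V) : Prog V V := Prog.add x y Prog.ret
def subP (x y : V) : Prog V V := Prog.sub x y Prog.ret
def mulP (x y : V) : Prog V V := Prog.mul x y Prog.ret
def divP (x y : V) : Prog V V := Prog.div x y Prog.ret
def sqrtP (x : V) : Prog V V := Prog.sqrt x Prog.ret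
def leP (x y : V) : Prog V Bool := Prog.le x y Prog.ret

/-- Compute and store an array of length `n`. -/
def tabulate {α : Type} : (n : ℕ) → (Fin n → Prog V α) → Prog V (Fin n → α)
  | 0, _ => pure Fin.elim0
  | n + 1, f => do
      let a ← f 0
      let as ← tabulate n fun i => f i.succ
      pure (Fin.cons a as)

/-- Compute and store an array with two indices. -/
def tabulate₂ {α : Type} (m n : ℕ) (f : Fin m → Fin n → Prog V α) :
    Prog V (Fin m → Fin n → α) :=
  tabulate m fun i => tabulate n (f i)

/-- The sum of `f i` over the indices `i` in the list. -/
def sumP {ι : Type} (is : List ι) (f : ι → Prog V V) : Prog V V := do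
  let z ← constP 0
  is.foldlM (fun acc i => do
    let t ← f i
    addP acc t) z

/-- The inner product `∑ i, u i * v i`. -/
def dotP {m : ℕ} (u v : Fin m → V) : Prog V V :=
  sumP (List.finRange m) fun i => mulP (u i) (v i)

/-- An index of the list at which `val` is largest (the first one in the order of the list). -/
def argmaxP {ι : Type} (val : ι → V) : List ι → Prog V (Option ι)
  | [] => pure none
  | i :: is => do
      let best ← is.foldlM (fun best j => do
        let b ← leP (val j) (val best)
        pure (if b then best else j)) i
      pure (some best)

/-- An index of the list at which `val` is smallest (the first one in the order of the list). -/
def argminP {ι : Type} (val : ι → V) : List ι → Prog V (Option ι)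
  | [] => pure none
  | i :: is => do
      let best ← is.foldlM (fun best j => do
        let b ← leP (val best) (val j)
        pure (if b then best else j)) i
      pure (some best)

end Instructions

/-- The list of the candidates in the order of the enumeration `e`.  A selection `i ∈ argmax` scans
this list; as `e` ranges over all enumerations, every way to resolve ties occurs. -/
def scan {N : ℕ} {ι : Type} (e : Fin N ≃ ι) (p : ι → Prop) [DecidablePred p] : List ι :=
  (List.ofFn e).filter fun i => decide (p i)

/-- `Loop body i st out t`: the loop that repeatedly runs `body`, entered with iteration number `i` in
the state `st`, is left with the result `out` after `t` arithmetic operations. -/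
inductive Loop {σ β : Type} (body : ℕ → σ → Prog ℝ (σ ⊕ β)) : ℕ → σ → β → ℕ → Prop
  | exit {i : ℕ} {st : σ} {out : β} (h : (body i st).eval = Sum.inr out) :
      Loop body i st out (body i st).cost
  | next {i : ℕ} {st st' : σ} {out : β} {t : ℕ} (h : (body i st).eval = Sum.inl st')
      (rest : Loop body (i + 1) st' out t) :
      Loop body i st out ((body i st).cost + t)

section Subroutines

variable {V : Type} {m n : ℕ}

/-- The orthogonal factor `Q` of the LQ decomposition of `X` (Gram-Schmidt on the rows). -/
def lqP (X : Fin m → Fin n → V) : Prog V (Fin m → Fin n → V) :=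
  (List.finRange m).foldlM (fun Q t => do
    let nsq ← dotP (Q t) (Q t)
    let nrm ← sqrtP nsq
    let row ← tabulate n fun j => divP (Q t j) nrm
    tabulate m fun i =>
      if i = t then pure row
      else if t < i then do
        let r ← dotP (Q i) row
        tabulate n fun j => do
          let p ← mulP r (row j)
          subP (Q i j) p
      else pure (Q i)) X

/-- One elimination step with pivot position `t` in a matrix `A` with rows indexed by `Fin m`;
`piv` holds the pivot column. -/
def eliminateP (t : Fin m) (piv : Fin m → V) (A : Fin m → Fin m → V) :
    Prog V (Fin m → Fin m → V) := do
  let row ← tabulate m fun j => divP (A t j) (piv t)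
  tabulate₂ m m fun i j =>
    if i = t then pure (row j)
    else do
      let p ← mulP (piv i) (row j)
      subP (A i j) p

/-- The inverse of a positive definite matrix by Gauss-Jordan elimination. -/
def inverseP (M : Fin m → Fin m → V) : Prog V (Fin m → Fin m → V) := do
  let one ← constP 1
  let zero ← constP 0
  let AB ← (List.finRange m).foldlM (fun (AB : (Fin m → Fin m → V) × (Fin m → Fin m → V)) t => do
    let A' ← eliminateP t (fun i => AB.1 i t) AB.1
    let B' ← eliminateP t (fun i => AB.1 i t) AB.2
    pure (A', B')) (M, fun i j => if i = j then one else zero)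
  pure AB.2

/-- `(X_S X_Sᵀ)⁻¹`. -/
def gramInverseP (X : Fin m → Fin n → V) (S : Finset (Fin n)) : Prog V (Fin m → Fin m → V) := do
  let M ← tabulate₂ m m fun a b =>
    sumP ((List.finRange n).filter (· ∈ S)) fun j => mulP (X a j) (X b j)
  inverseP M

/-- The vector `Y x_s`. -/
def applyP (X : Fin m → Fin n → V) (Y : Fin m → Fin m → V) (s : Fin n) : Prog V (Fin m → V) :=
  tabulate m fun a => dotP (Y a) fun b => X b s

/-- The array `w j = yᵀ x_j`. -/
def againstP (X : Fin m → Fin n → V) (y : Fin m → V) : Prog V (Fin n → V) :=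
  tabulate n fun j => dotP y fun a => X a j

/-- The array `l j - w j ^ 2 / d`. -/
def lessSqP (l w : Fin n → V) (d : V) : Prog V (Fin n → V) :=
  tabulate n fun j => do
    let q ← mulP (w j) (w j)
    let f ← divP q d
    subP (l j) f

/-- The array `l j + w j ^ 2 / d`. -/
def plusSqP (l w : Fin n → V) (d : V) : Prog V (Fin n → V) :=
  tabulate n fun j => do
    let q ← mulP (w j) (w j)
    let f ← divP q d
    addP (l j) f

/-- The matrix `Y - y yᵀ / d`. -/
def lessRankOneP (Y : Fin m → Fin m → V) (y : Fin m → V) (d : V) : Prog V (Fin m → Fin m → V) :=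
  tabulate₂ m m fun a b => do
    let q ← mulP (y a) (y b)
    let f ← divP q d
    subP (Y a b) f

/-- The matrix `Y + y yᵀ / d`. -/
def plusRankOneP (Y : Fin m → Fin m → V) (y : Fin m → V) (d : V) : Prog V (Fin m → Fin m → V) :=
  tabulate₂ m m fun a b => do
    let q ← mulP (y a) (y b)
    let f ← divP q d
    addP (Y a b) f

end Subroutines

/-! ### Dominant-split -/

/-- The working data: the selected set `S`, the matrix `Y = (X_S X_Sᵀ)⁻¹`, and the array
`l j = x_jᵀ Y x_j`. -/
structure SplitState (V : Type) (m n : ℕ) where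
  S : Finset (Fin n)
  Y : Fin m → Fin m → V
  l : Fin n → V

section DominantSplit

variable {V : Type} {m n : ℕ}

def splitInit (X : Fin m → Fin n → V) (S : Finset (Fin n)) : Prog V (SplitState V m n) := do
  let Y ← gramInverseP X S
  let l ← tabulate n fun j => do
    let y ← applyP X Y j
    dotP y fun a => X a j
  pure ⟨S, Y, l⟩

/-- One pass of the main loop; `Sum.inr` leaves the loop.  The enumerations `eAdd` and `eRem` resolve
ties in the choice of the added and the removed column. -/
def splitBody (X : Fin m → Fin n → V) (c : V) (eAdd eRem : Fin n ≃ Fin n) (st : SplitState V m n) :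
    Prog V (SplitState V m n ⊕ Finset (Fin n)) := do
  match ← argmaxP st.l (scan eAdd (· ∉ st.S)) with
  | none => pure (Sum.inr st.S)
  | some s =>
    let one ← constP 1
    let y ← applyP X st.Y s
    let w ← againstP X y
    let d ← addP one (st.l s)
    let l' ← lessSqP st.l w d
    let Y' ← lessRankOneP st.Y y d
    match ← argminP l' (scan eRem (· ∈ st.S)) with
    | none => pure (Sum.inr st.S)
    | some r =>
      let e ← subP one (l' r)
      let gain ← mulP d e
      let csq ← mulP c c
      let small ← leP gain csq
      if small then pure (Sum.inr st.S)
      else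
        let y' ← applyP X Y' r
        let w' ← againstP X y'
        let l'' ← plusSqP l' w' e
        let Y'' ← plusRankOneP Y' y' e
        pure (Sum.inl ⟨(insert s st.S).erase r, Y'', l''⟩)

/-- The preprocessing step: optionally (flag `lq`) replace `X` by the orthogonal factor of its LQ
decomposition. -/
def splitPrep (lq : Bool) (X : Fin m → Fin n → V) : Prog V (Fin m → Fin n → V) :=
  if lq then lqP X else pure X

def splitStart (lq : Bool) (X : Fin m → Fin n → V) (S : Finset (Fin n)) :
    Prog V ((Fin m → Fin n → V) × SplitState V m n) := do
  let Q ← splitPrep lq X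
  let st ← splitInit Q S
  pure (Q, st)

end DominantSplit

/-- A way to resolve ties in all iterations of Dominant-split. -/
structure SplitTies (n : ℕ) where
  eAdd : ℕ → (Fin n ≃ Fin n)
  eRem : ℕ → (Fin n ≃ Fin n)

/-- `DominantSplit lq ties X c S S' T`: Dominant-split, called with the matrix `X`, the starting set `S`
and the parameter `c`, terminates with the set `S'` after `T` arithmetic operations in total. -/
def DominantSplit {m n : ℕ} (lq : Bool) (ties : SplitTies n) (X : Matrix (Fin m) (Fin n) ℝ) (c : ℝ)
    (S S' : Finset (Fin n)) (T : ℕ) : Prop :=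
  ∃ t : ℕ,
    Loop (fun i => splitBody (splitStart lq X S).eval.1 c (ties.eAdd i) (ties.eRem i))
      0 (splitStart lq X S).eval.2 S' t ∧
    T = (splitStart lq X S).cost + t

/-! ### The Dominant algorithm -/

/-- The working data: the selected set `S`, the rows `i ∈ S` of the matrix `C i j = x_iᵀ Y x_j`
with `Y = (X_S X_Sᵀ)⁻¹`, that is, the matrix `X_S† X` (rows `i ∉ S` are not in use), and the array
`l j = x_jᵀ Y x_j`. -/
structure DominantState (V : Type) (n : ℕ) where
  S : Finset (Fin n)
  C : Fin n → Fin n → V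
  l : Fin n → V

section Dominant

variable {V : Type} {m n : ℕ}

def dominantInit (X : Fin m → Fin n → V) (S : Finset (Fin n)) : Prog V (DominantState V n) := do
  let Y ← gramInverseP X S
  let P ← tabulate n fun j => applyP X Y j
  let zero ← constP 0
  let C ← tabulate n fun i =>
    if i ∈ S then tabulate n fun j => dotP (fun a => X a i) (P j)
    else pure fun _ => zero
  let l ← tabulate n fun j => dotP (fun a => X a j) (P j)
  pure ⟨S, C, l⟩

/-- One pass of the main loop; `Sum.inr` leaves the loop.  The array `B` holds the ratios
`Vol² (X_{S + s - r}) / Vol² (X_S) = (1 + l s) * (1 - l r) + C r s ^ 2` for all exchanges, and a best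
exchange is carried out if it increases the volume by a factor greater than `c`.  The enumeration `e`
resolves ties. -/
def dominantBody (c : V) (e : Fin (n * n) ≃ Fin n × Fin n) (st : DominantState V n) :
    Prog V (DominantState V n ⊕ Finset (Fin n)) := do
  let one ← constP 1
  let B ← tabulate n fun r =>
    if r ∈ st.S then tabulate n fun s => do
      let a ← addP one (st.l s)
      let b ← subP one (st.l r)
      let ab ← mulP a b
      let q ← mulP (st.C r s) (st.C r s)
      addP ab q
    else pure (st.C r)
  match ← argmaxP (fun p : Fin n × Fin n => B p.1 p.2)
      (scan e fun p => p.1 ∈ st.S ∧ p.2 ∉ st.S) with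
  | none => pure (Sum.inr st.S)
  | some (r, s) =>
    let csq ← mulP c c
    let small ← leP (B r s) csq
    if small then pure (Sum.inr st.S)
    else
      -- adding `s`: `u j = x_sᵀ Y x_j`, `v j = x_sᵀ Y' x_j`
      let u ← tabulate n fun j =>
        sumP ((List.finRange n).filter (· ∈ st.S)) fun i => mulP (st.C i s) (st.C i j)
      let d ← addP one (st.l s)
      let v ← tabulate n fun j => divP (u j) d
      let l' ← lessSqP st.l u d
      -- removing `r`: `z j = x_rᵀ Y' x_j`
      let f ← subP one (l' r)
      let z ← tabulate n fun j => do
        let p ← mulP (st.C r s) (v j)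
        subP (st.C r j) p
      let l'' ← plusSqP l' z f
      let C'' ← tabulate n fun i =>
        if i ∈ (insert s st.S).erase r then do
          let zi ← divP (z i) f
          tabulate n fun j => do
            let g ← if i = s then pure (v j) else do
              let p ← mulP (st.C i s) (v j)
              subP (st.C i j) p
            let h ← mulP zi (z j)
            addP g h
        else pure (st.C i)
      pure (Sum.inl ⟨(insert s st.S).erase r, C'', l''⟩)

end Dominant

/-- `Dominant ties X c S S' T`: the Dominant algorithm, called with the matrix `X`, the starting set `S`
and the parameter `c`, terminates with the set `S'` after `T` arithmetic operations in total. -/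
def Dominant {m n : ℕ} (ties : ℕ → (Fin (n * n) ≃ Fin n × Fin n)) (X : Matrix (Fin m) (Fin n) ℝ)
    (c : ℝ) (S S' : Finset (Fin n)) (T : ℕ) : Prop :=
  ∃ t : ℕ,
    Loop (fun i => dominantBody c (ties i)) 0 (dominantInit X S).eval S' t ∧
    T = (dominantInit X S).cost + t

/-! ### Advanced initialization -/

/-- The `j`-th column of `X` as a Euclidean vector. -/
noncomputable def column {m n : ℕ} (X : Matrix (Fin m) (Fin n) ℝ) (j : Fin n) :
    EuclideanSpace ℝ (Fin m) :=
  WithLp.toLp 2 fun i => X i j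

/-- `p 0, p 1, …` are the pivots chosen by column pivoted QR: each one is a column with the largest
component orthogonal to the columns already selected. -/
def IsCPQR {m n : ℕ} (X : Matrix (Fin m) (Fin n) ℝ) (p : Fin m → Fin n) : Prop :=
  Function.Injective p ∧ ∀ (i : Fin m) (j : Fin n),
    ‖((Submodule.span ℝ ((fun a => column X (p a)) '' {a | a < i}))ᗮ).starProjection (column X j)‖ ≤
    ‖((Submodule.span ℝ ((fun a => column X (p a)) '' {a | a < i}))ᗮ).starProjection
      (column X (p i))‖

section Greedy

variable {V : Type} {m n : ℕ}

/-- Remove a column with the smallest `l`. -/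
def removeP (X : Fin m → Fin n → V) (e : Fin n ≃ Fin n) (st : SplitState V m n) :
    Prog V (SplitState V m n) := do
  match ← argminP st.l (scan e (· ∈ st.S)) with
  | none => pure st
  | some r =>
    let one ← constP 1
    let d ← subP one (st.l r)
    let y ← applyP X st.Y r
    let w ← againstP X y
    let l' ← plusSqP st.l w d
    let Y' ← plusRankOneP st.Y y d
    pure ⟨st.S.erase r, Y', l'⟩

/-- Append a column with the largest `l`. -/
def appendP (X : Fin m → Fin n → V) (e : Fin n ≃ Fin n) (st : SplitState V m n) :
    Prog V (SplitState V m n) := do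
  match ← argmaxP st.l (scan e (· ∉ st.S)) with
  | none => pure st
  | some s =>
    let one ← constP 1
    let d ← addP one (st.l s)
    let y ← applyP X st.Y s
    let w ← againstP X y
    let l' ← lessSqP st.l w d
    let Y' ← lessRankOneP st.Y y d
    pure ⟨insert s st.S, Y', l'⟩

/-- Bring the set `S` to `k` elements by greedily removing or appending columns. -/
def resizeP (X : Fin m → Fin n → V) (k : ℕ) (e : ℕ → (Fin n ≃ Fin n)) (S : Finset (Fin n)) :
    Prog V (Finset (Fin n)) := do
  let st ← splitInit X S
  let st' ←
    if k ≤ S.card then (List.range (S.card - k)).foldlM (fun st i => removeP X (e i) st) st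
    else (List.range (k - S.card)).foldlM (fun st i => appendP X (e i) st) st
  pure st'.S

end Greedy

/-- The exchange parameter of the advanced initialization, `c² = min (e, 1 + 2m / (2m - 1))`. -/
noncomputable def advParam (m : ℕ) : ℝ :=
  Real.sqrt (min (Real.exp 1) (1 + 2 * (m : ℝ) / (2 * (m : ℝ) - 1)))

/-- `AdvancedInit X k S`: the set `S` is a possible result of the advanced initialization.  A set of
`2m - 1` columns (all columns, if there are fewer) that contains the pivots of column pivoted QR is
improved by Dominant-split, and then brought to `k` columns by greedy removals or additions. -/
def AdvancedInit {m n : ℕ} (X : Matrix (Fin m) (Fin n) ℝ) (k : ℕ) (S : Finset (Fin n)) : Prop :=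
  ∃ (p : Fin m → Fin n) (S₀ S₁ : Finset (Fin n)) (lq : Bool) (ties : SplitTies n) (T : ℕ)
    (e : ℕ → (Fin n ≃ Fin n)),
    IsCPQR X p ∧ (∀ i, p i ∈ S₀) ∧ S₀.card = min (2 * m - 1) n ∧
    DominantSplit lq ties X (advParam m) S₀ S₁ T ∧
    S = (resizeP X k e S₁).eval

/-- `Vol (X_S) = √(det (X_S X_Sᵀ))`. -/
noncomputable def vol {m n : ℕ} (X : Matrix (Fin m) (Fin n) ℝ) (S : Finset (Fin n)) : ℝ :=
  let XS : Matrix (Fin m) S ℝ := X.submatrix id Subtype.val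
  Real.sqrt (XS * XS.transpose).det

end ColumnExchange

/-! Write `gram X S` for the sum of x_j x_jᵀ over j in S, so that its determinant is the squared
volume. With Y its inverse, the leverages l_j = x_jᵀ Y x_j control everything. They sum to m over S.
Inserting a column multiplies the determinant by 1 + l_s, and erasing one multiplies it by 1 - l_r.
The AM-GM inequality for eigenvalues bounds det `gram X T` by (∑_{j ∈ T} l_j / m)^m det `gram X S`
for every T (`IsGramInv.det_gram_le`).

Quality of the initialization: when Dominant-split stops at 2m - 1 columns, averaging the leverages
after the tentative insertion forces l_j ≤ 3 for all j (`IsGramInv.cross_self_le_three`); if all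
columns are selected, l_j ≤ 1. Hence every T satisfies det `gram X T` ≤ (3|T|/m)^m det `gram X S₁`.
A greedy removal costs at most the factor 1 - m/(p+1) = C(p,m)/C(p+1,m), which telescopes. The same
argument applied inside a competitor U of size k yields m columns J of U with det `gram X U` ≤
C(k,m) det `gram X J`. The factors C(k,m) cancel, which leaves 3^m C(2m-1,m). For greedy insertion,
(|S|/(6k))^m det `gram X U` ≤ det `gram X S` is preserved by each step (`IsGramInv.det_insert_ge`),
and at |S| = k the factor is 6^(-m).

Operation counts: both bounds are at most 12^m in squared volume, and each exchange gains a factor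
above c². So there are O(1 + m / log c) passes, each costing O(nm) for Dominant-split and O(nk) for
the Dominant algorithm. What remains is that the programs maintain the quantities they claim to:
Gauss-Jordan inversion, rank-one updates, and the invertible change of coordinates made by the LQ
step. -/

namespace ColumnExchange

open Matrix

/-! ### Results and operation counts of composed programs -/

namespace Prog

variable {α β : Type}

@[simp] theorem eval_pure (a : α) : (pure a : Prog ℝ α).eval = a := rfl

@[simp] theorem cost_pure (a : α) : (pure a : Prog ℝ α).cost = 0 := rfl

@[simp] theorem eval_bind (x : Prog ℝ α) (f : α → Prog ℝ β) :
    (x >>= f).eval = (f x.eval).eval := by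
  change (x.bind f).eval = _
  induction x with
  | le x y k ih => exact ih _
  | _ => simp_all [Prog.bind, Prog.eval]

@[simp] theorem cost_bind (x : Prog ℝ α) (f : α → Prog ℝ β) :
    (x >>= f).cost = x.cost + (f x.eval).cost := by
  change (x.bind f).cost = _
  induction x with
  | le x y k ih => simpa only [Prog.bind, Prog.eval, Prog.cost, add_assoc] using congrArg _ (ih _)
  | _ => simp_all [Prog.bind, Prog.eval, Prog.cost, add_assoc]

theorem eval_ite (b : Bool) (p q : Prog ℝ α) :
    (if b = true then p else q).eval = bif b then p.eval else q.eval := by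
  cases b <;> rfl

theorem cost_ite_le (b : Bool) {p q : Prog ℝ α} {B : ℕ} (hp : p.cost ≤ B) (hq : q.cost ≤ B) :
    (if b = true then p else q).cost ≤ B := by
  cases b <;> assumption

theorem eval_foldlM {ι : Type} (f : α → ι → Prog ℝ α) (l : List ι) (a : α) :
    (l.foldlM f a).eval = l.foldl (fun a i => (f a i).eval) a := by
  induction l generalizing a with
  | nil => rfl
  | cons i l ih => simp [ih]

theorem cost_foldlM_le {ι : Type} (f : α → ι → Prog ℝ α) (B : ℕ) (h : ∀ a i, (f a i).cost ≤ B)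
    (l : List ι) (a : α) : (l.foldlM f a).cost ≤ l.length * B := by
  induction l generalizing a with
  | nil => simp
  | cons i l ih =>
    have h1 := h a i
    have h2 := ih (f a i).eval
    simp only [List.foldlM_cons, cost_bind, List.length_cons, add_mul, one_mul]
    omega

end Prog

/-! ### Arrays, sums and selections -/

section Instructions

@[simp] theorem eval_constP (z : ℤ) : (constP z : Prog ℝ ℝ).eval = z := rfl
@[simp] theorem eval_addP (x y : ℝ) : (addP x y).eval = x + y := rfl
@[simp] theorem eval_subP (x y : ℝ) : (subP x y).eval = x - y := rfl
@[simp] theorem eval_mulP (x y : ℝ) : (mulP x y).eval = x * y := rfl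
@[simp] theorem eval_divP (x y : ℝ) : (divP x y).eval = x / y := rfl
@[simp] theorem eval_sqrtP (x : ℝ) : (sqrtP x).eval = Real.sqrt x := rfl
@[simp] theorem eval_leP (x y : ℝ) : (leP x y).eval = decide (x ≤ y) := rfl
@[simp] theorem cost_constP (z : ℤ) : (constP z : Prog ℝ ℝ).cost = 1 := rfl
@[simp] theorem cost_addP (x y : ℝ) : (addP x y).cost = 1 := rfl
@[simp] theorem cost_subP (x y : ℝ) : (subP x y).cost = 1 := rfl
@[simp] theorem cost_mulP (x y : ℝ) : (mulP x y).cost = 1 := rfl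
@[simp] theorem cost_divP (x y : ℝ) : (divP x y).cost = 1 := rfl
@[simp] theorem cost_sqrtP (x : ℝ) : (sqrtP x).cost = 1 := rfl
@[simp] theorem cost_leP (x y : ℝ) : (leP x y).cost = 1 := rfl

@[simp] theorem eval_tabulate {α : Type} (n : ℕ) (f : Fin n → Prog ℝ α) :
    (tabulate n f).eval = fun i => (f i).eval := by
  induction n with
  | zero => exact funext fun i => i.elim0
  | succ n ih =>
    funext i
    simp only [tabulate, Prog.eval_bind, ih, Prog.eval_pure]
    refine Fin.cases ?_ (fun i => ?_) i <;> simp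

theorem cost_tabulate {α : Type} (n : ℕ) (f : Fin n → Prog ℝ α) :
    (tabulate n f).cost = ∑ i, (f i).cost := by
  induction n with
  | zero => rfl
  | succ n ih => simp [tabulate, ih, Fin.sum_univ_succ]

theorem cost_tabulate_le {α : Type} {n : ℕ} {f : Fin n → Prog ℝ α} {B : ℕ}
    (h : ∀ i, (f i).cost ≤ B) : (tabulate n f).cost ≤ n * B := by
  rw [cost_tabulate]
  simpa using Finset.sum_le_card_nsmul Finset.univ (fun i => (f i).cost) B fun i _ => h i

/-- For arrays in which the rows outside S are copied for free. This is what makes the Dominant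
algorithm pay for |S| rows and not for n. -/
theorem cost_tabulate_le_card {α : Type} {n : ℕ} {f : Fin n → Prog ℝ α} {B : ℕ}
    (S : Finset (Fin n)) (h : ∀ i ∈ S, (f i).cost ≤ B) (h₀ : ∀ i ∉ S, (f i).cost = 0) :
    (tabulate n f).cost ≤ S.card * B := by
  rw [cost_tabulate, ← Finset.sum_subset S.subset_univ fun i _ hi => h₀ i hi]
  simpa using Finset.sum_le_card_nsmul S (fun i => (f i).cost) B h

@[simp] theorem eval_tabulate₂ {α : Type} (m n : ℕ) (f : Fin m → Fin n → Prog ℝ α) :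
    (tabulate₂ m n f).eval = fun i j => (f i j).eval := by
  simp [tabulate₂]

theorem cost_tabulate₂_le {α : Type} {m n : ℕ} {f : Fin m → Fin n → Prog ℝ α} {B : ℕ}
    (h : ∀ i j, (f i j).cost ≤ B) : (tabulate₂ m n f).cost ≤ m * (n * B) :=
  cost_tabulate_le fun i => cost_tabulate_le (h i)

theorem eval_sumP {ι : Type} (is : List ι) (f : ι → Prog ℝ ℝ) :
    (sumP is f).eval = (is.map fun i => (f i).eval).sum := by
  have key : ∀ a : ℝ, is.foldl (fun a i => a + (f i).eval) a
      = a + (is.map fun i => (f i).eval).sum := by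
    induction is with
    | nil => simp
    | cons i is ih => intro a; simp [ih, add_assoc]
  simp [sumP, Prog.eval_foldlM, key]

theorem cost_sumP_le {ι : Type} (is : List ι) {f : ι → Prog ℝ ℝ} {B : ℕ}
    (h : ∀ i, (f i).cost ≤ B) : (sumP is f).cost ≤ 1 + is.length * (B + 1) := by
  simp only [sumP, Prog.cost_bind, cost_constP]
  gcongr
  refine Prog.cost_foldlM_le _ _ (fun a i => ?_) _ _
  simpa using h i

theorem length_filter_finRange {n : ℕ} (S : Finset (Fin n)) :
    ((List.finRange n).filter (· ∈ S)).length = S.card := by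
  have hn : ((List.finRange n).filter (· ∈ S)).Nodup := (List.nodup_finRange n).filter _
  rw [← List.toFinset_card_of_nodup hn]
  congr 1
  ext; simp

theorem eval_sumP_filter {n : ℕ} (S : Finset (Fin n)) (f : Fin n → Prog ℝ ℝ) :
    (sumP ((List.finRange n).filter (· ∈ S)) f).eval = ∑ j ∈ S, (f j).eval := by
  have hn : ((List.finRange n).filter (· ∈ S)).Nodup := (List.nodup_finRange n).filter _
  rw [eval_sumP, ← List.sum_toFinset _ hn]
  congr 1
  ext; simp

@[simp] theorem eval_dotP {m : ℕ} (u v : Fin m → ℝ) : (dotP u v).eval = u ⬝ᵥ v := by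
  simp [dotP, eval_sumP, dotProduct, Fin.sum_univ_def]

theorem cost_dotP {m : ℕ} (u v : Fin m → ℝ) : (dotP u v).cost ≤ 1 + 2 * m := by
  have := cost_sumP_le (List.finRange m) (f := fun i => mulP (u i) (v i)) (B := 1) (by simp)
  simp only [List.length_finRange] at this
  unfold dotP
  omega

theorem argmaxP_spec {ι : Type} (val : ι → ℝ) (l : List ι) :
    ((argmaxP val l).eval = none ∧ l = []) ∨
      ∃ s ∈ l, (argmaxP val l).eval = some s ∧ ∀ j ∈ l, val j ≤ val s := by
  rcases l with _ | ⟨i, l⟩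
  · exact Or.inl ⟨rfl, rfl⟩
  right
  have key : ∀ (l : List ι) (i : ι), ∃ s ∈ i :: l,
      l.foldl (fun best j => if val j ≤ val best then best else j) i = s ∧
        ∀ j ∈ i :: l, val j ≤ val s := by
    intro l
    induction l with
    | nil => intro i; exact ⟨i, by simp, rfl, by simp⟩
    | cons k l ih =>
      intro i
      simp only [List.foldl_cons]
      split_ifs with h
      · obtain ⟨s, hs, he, hm⟩ := ih i
        refine ⟨s, by simp_all; tauto, he, ?_⟩
        simp only [List.mem_cons, forall_eq_or_imp] at hm ⊢
        exact ⟨hm.1, h.trans hm.1, hm.2⟩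
      · obtain ⟨s, hs, he, hm⟩ := ih k
        refine ⟨s, by simp_all, he, ?_⟩
        simp only [List.mem_cons, forall_eq_or_imp] at hm ⊢
        exact ⟨(not_le.1 h).le.trans hm.1, hm.1, hm.2⟩
  obtain ⟨s, hs, he, hm⟩ := key l i
  refine ⟨s, hs, ?_, hm⟩
  simp [argmaxP, Prog.eval_foldlM, ← he]

theorem argminP_spec {ι : Type} (val : ι → ℝ) (l : List ι) :
    ((argminP val l).eval = none ∧ l = []) ∨
      ∃ s ∈ l, (argminP val l).eval = some s ∧ ∀ j ∈ l, val s ≤ val j := by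
  have h : (argminP val l).eval = (argmaxP (fun i => -val i) l).eval := by
    cases l <;> simp [argminP, argmaxP, Prog.eval_foldlM]
  rw [h]
  simpa using argmaxP_spec (fun i => -val i) l

theorem cost_argmaxP_le {ι : Type} (val : ι → ℝ) (l : List ι) :
    (argmaxP val l).cost ≤ l.length := by
  rcases l with _ | ⟨i, l⟩
  · simp [argmaxP]
  have := Prog.cost_foldlM_le (fun best j => do
        let b ← leP (val j) (val best)
        pure (if b then best else j)) 1 (by simp) l i
  simp only [argmaxP, Prog.cost_bind, Prog.cost_pure, List.length_cons]
  omega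

theorem cost_argminP_le {ι : Type} (val : ι → ℝ) (l : List ι) :
    (argminP val l).cost ≤ l.length := by
  rcases l with _ | ⟨i, l⟩
  · simp [argminP]
  have := Prog.cost_foldlM_le (fun best j => do
        let b ← leP (val best) (val j)
        pure (if b then best else j)) 1 (by simp) l i
  simp only [argminP, Prog.cost_bind, Prog.cost_pure, List.length_cons]
  omega

end Instructions

/-! ### Candidate lists and termination of loops -/

theorem mem_scan {N : ℕ} {ι : Type} {e : Fin N ≃ ι} {p : ι → Prop} [DecidablePred p] {i : ι} :
    i ∈ scan e p ↔ p i := by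
  simp only [scan, List.mem_filter, List.mem_ofFn, decide_eq_true_eq, and_iff_right_iff_imp]
  exact fun _ => ⟨e.symm i, by simp⟩

theorem length_scan_le {N : ℕ} {ι : Type} (e : Fin N ≃ ι) (p : ι → Prop) [DecidablePred p] :
    (scan e p).length ≤ N :=
  (List.length_filter_le _ _).trans (by simp)

/-- Limits the search for an exchange to |S|·n comparisons, where the enumeration itself has length
n². -/
theorem length_scan_le_card {N : ℕ} {ι : Type} [DecidableEq ι] (e : Fin N ≃ ι) (p : ι → Prop)
    [DecidablePred p] (A : Finset ι) (h : ∀ i, p i → i ∈ A) : (scan e p).length ≤ A.card := by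
  have hn : (scan e p).Nodup := (List.nodup_ofFn.2 e.injective).filter _
  rw [← List.toFinset_card_of_nodup hn]
  exact Finset.card_le_card fun i hi => h i (mem_scan.1 (List.mem_toFinset.1 hi))

/-- A loop that multiplies a bounded potential by more than `q` in each pass terminates. -/
theorem Loop.exists_of_potential {σ β : Type} {body : ℕ → σ → Prog ℝ (σ ⊕ β)} (Inv : σ → Prop)
    (pot : σ → ℝ) {M q : ℝ} {C : ℕ} (hq : 0 ≤ q)
    (hpot : ∀ st, Inv st → pot st ≤ M)
    (hcost : ∀ i st, Inv st → (body i st).cost ≤ C)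
    (hstep : ∀ i st st', Inv st → (body i st).eval = Sum.inl st' →
      Inv st' ∧ pot st * q ≤ pot st')
    (N i : ℕ) (st : σ) (hst : Inv st) (hN : M < pot st * q ^ (N + 1)) :
    ∃ out t, Loop body i st out t ∧ t ≤ (N + 1) * C := by
  induction N generalizing i st with
  | zero =>
    rcases h : (body i st).eval with st' | out
    -- One more exchange would push the potential beyond M, so this pass must be the exit.
    · obtain ⟨h1, h2⟩ := hstep i st st' hst h
      have := hpot st' h1
      simp at hN
      linarith
    · exact ⟨out, _, .exit h, by simpa using hcost i st hst⟩
  | succ N ih =>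
    rcases h : (body i st).eval with st' | out
    · obtain ⟨h1, h2⟩ := hstep i st st' hst h
      obtain ⟨out, t, hl, ht⟩ := ih (i + 1) st' h1 <| hN.trans_le <| by
        rw [pow_succ' q (N + 1), ← mul_assoc]
        gcongr
      refine ⟨out, _, .next h hl, ?_⟩
      have := hcost i st hst
      rw [add_mul (N + 1)]
      omega
    · refine ⟨out, _, .exit h, (hcost i st hst).trans ?_⟩
      exact Nat.le_mul_of_pos_left _ (by omega)

/-! ### Gram matrices, rank-one updates and leverages -/

section LinearAlgebra

variable {m n : ℕ}

/-- The AM-GM inequality for the eigenvalues. -/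
theorem _root_.Matrix.PosSemidef.det_le_trace_div_pow {A : Matrix (Fin m) (Fin m) ℝ}
    (hA : A.PosSemidef) (hm : 1 ≤ m) : A.det ≤ (A.trace / m) ^ m := by
  have hm' : (0 : ℝ) < m := by exact_mod_cast hm
  have hz := hA.eigenvalues_nonneg
  have h := Real.geom_mean_le_arith_mean Finset.univ (fun _ => (1 : ℝ)) hA.1.eigenvalues
    (fun _ _ => zero_le_one) (by simpa using hm') (fun i _ => hz i)
  simp only [Real.rpow_one, one_mul, Finset.sum_const, Finset.card_univ, Fintype.card_fin,
    nsmul_eq_mul, mul_one] at h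
  have hp : 0 ≤ ∏ i, hA.1.eigenvalues i := Finset.prod_nonneg fun i _ => hz i
  have h2 := pow_le_pow_left₀ (Real.rpow_nonneg hp _) h m
  rw [← Real.rpow_natCast, ← Real.rpow_mul hp, inv_mul_cancel₀ hm'.ne', Real.rpow_one] at h2
  rw [hA.1.det_eq_prod_eigenvalues, hA.1.trace_eq_sum_eigenvalues]
  simpa using h2

/-- The matrix `X_S X_Sᵀ`. -/
def gram (X : Matrix (Fin m) (Fin n) ℝ) (S : Finset (Fin n)) : Matrix (Fin m) (Fin m) ℝ :=
  ∑ j ∈ S, vecMulVec (Xᵀ j) (Xᵀ j)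

theorem gram_apply (X : Matrix (Fin m) (Fin n) ℝ) (S : Finset (Fin n)) (a b : Fin m) :
    gram X S a b = ∑ j ∈ S, X a j * X b j := by
  simp [gram, Matrix.sum_apply, vecMulVec_apply]

theorem vol_eq_sqrt_det_gram (X : Matrix (Fin m) (Fin n) ℝ) (S : Finset (Fin n)) :
    vol X S = Real.sqrt (gram X S).det := by
  unfold vol
  have h : X.submatrix id ((↑) : S → Fin n) * (X.submatrix id ((↑) : S → Fin n))ᵀ = gram X S := by
    ext a b
    rw [gram_apply, ← Finset.sum_coe_sort S]
    simp [Matrix.mul_apply]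
  exact congrArg _ (congrArg det h)

theorem gram_posSemidef (X : Matrix (Fin m) (Fin n) ℝ) (S : Finset (Fin n)) :
    (gram X S).PosSemidef :=
  posSemidef_sum S fun j _ => by simpa using posSemidef_vecMulVec_self_star (Xᵀ j)

theorem gram_insert (X : Matrix (Fin m) (Fin n) ℝ) {S : Finset (Fin n)} {s : Fin n}
    (hs : s ∉ S) : gram X (insert s S) = gram X S + (1 : ℝ) • vecMulVec (Xᵀ s) (Xᵀ s) := by
  rw [gram, Finset.sum_insert hs, one_smul, add_comm]; rfl

theorem gram_erase (X : Matrix (Fin m) (Fin n) ℝ) {S : Finset (Fin n)} {r : Fin n}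
    (hr : r ∈ S) : gram X (S.erase r) = gram X S + (-1 : ℝ) • vecMulVec (Xᵀ r) (Xᵀ r) := by
  rw [gram, gram, ← Finset.sum_erase_add S _ hr]
  simp

theorem gram_mul_left (A : Matrix (Fin m) (Fin m) ℝ) (X : Matrix (Fin m) (Fin n) ℝ)
    (S : Finset (Fin n)) : gram (A * X) S = A * gram X S * Aᵀ := by
  simp only [gram, Matrix.mul_sum, Matrix.sum_mul]
  refine Finset.sum_congr rfl fun j _ => ?_
  rw [mul_vecMulVec, vecMulVec_mul, vecMul_transpose]
  rfl

/-- A change of coordinates rescales all squared volumes by the same factor, so volume ratios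
survive the LQ step. -/
theorem det_gram_mul_left (A : Matrix (Fin m) (Fin m) ℝ) (X : Matrix (Fin m) (Fin n) ℝ)
    (S : Finset (Fin n)) : (gram (A * X) S).det = A.det ^ 2 * (gram X S).det := by
  rw [gram_mul_left, det_mul, det_mul, det_transpose]; ring

/-- The bilinear form `x_iᵀ Y x_j` in the columns of `X`. -/
def cross (X : Matrix (Fin m) (Fin n) ℝ) (Y : Matrix (Fin m) (Fin m) ℝ) (i j : Fin n) : ℝ :=
  Xᵀ i ⬝ᵥ (Y *ᵥ Xᵀ j)

theorem cross_comm (X : Matrix (Fin m) (Fin n) ℝ) {Y : Matrix (Fin m) (Fin m) ℝ}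
    (hY : Yᵀ = Y) (i j : Fin n) : cross X Y i j = cross X Y j i := by
  rw [cross, cross, dotProduct_mulVec, ← mulVec_transpose, hY, dotProduct_comm]

theorem dotProduct_mulVec_eq_cross (X : Matrix (Fin m) (Fin n) ℝ) (Y : Matrix (Fin m) (Fin m) ℝ)
    (i j : Fin n) : (Y *ᵥ Xᵀ i) ⬝ᵥ Xᵀ j = cross X Y j i :=
  dotProduct_comm _ _

section RankOne

variable {G Y : Matrix (Fin m) (Fin m) ℝ}

/-- The Sherman-Morrison formula. -/
theorem rankOne_mul_eq_one (hY : Yᵀ = Y) (h : Y * G = 1) (x : Fin m → ℝ) (t : ℝ)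
    (hd : 1 + t * (x ⬝ᵥ (Y *ᵥ x)) ≠ 0) :
    (Y - (t / (1 + t * (x ⬝ᵥ (Y *ᵥ x)))) • vecMulVec (Y *ᵥ x) (Y *ᵥ x)) *
      (G + t • vecMulVec x x) = 1 := by
  have h1 : (Y *ᵥ x) ᵥ* G = x := by
    rw [← vecMul_transpose, hY, vecMul_vecMul, h, vecMul_one]
  rw [Matrix.sub_mul, Matrix.mul_add, h, Matrix.mul_smul, mul_vecMulVec, Matrix.smul_mul,
    Matrix.mul_add, vecMulVec_mul, h1, Matrix.mul_smul, vecMulVec_mul_vecMulVec,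
    dotProduct_comm (Y *ᵥ x) x]
  generalize x ⬝ᵥ (Y *ᵥ x) = l at *
  rw [add_sub_assoc, add_eq_left, vecMulVec_smul, smul_smul]
  generalize vecMulVec (Y *ᵥ x) x = M
  have h2 : t • M - (t / (1 + t * l)) • (M + (t * l) • M)
      = (t - t / (1 + t * l) * (1 + t * l)) • M := by module
  rw [h2, div_mul_cancel₀ _ hd, sub_self, zero_smul]

/-- Factor the updated matrix as G (1 + t (Yx) xᵀ) and apply the matrix determinant lemma. -/
theorem det_rankOne (h : Y * G = 1) (x : Fin m → ℝ) (t : ℝ) :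
    (G + t • vecMulVec x x).det = G.det * (1 + t * (x ⬝ᵥ (Y *ᵥ x))) := by
  have hG : G * Y = 1 := mul_eq_one_comm.1 h
  have h2 : G + t • vecMulVec x x
      = G * (1 + replicateCol Unit (t • (Y *ᵥ x)) * replicateRow Unit x) := by
    rw [← vecMulVec_eq, Matrix.mul_add, Matrix.mul_one, mul_vecMulVec, mulVec_smul, mulVec_mulVec,
      hG, one_mulVec, smul_vecMulVec]
  rw [h2, det_mul, det_one_add_replicateCol_mul_replicateRow, dotProduct_smul, smul_eq_mul]

end RankOne

/-- `Y = (X_S X_Sᵀ)⁻¹`. -/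
def IsGramInv (X : Matrix (Fin m) (Fin n) ℝ) (S : Finset (Fin n)) (Y : Matrix (Fin m) (Fin m) ℝ) :
    Prop :=
  Y * gram X S = 1

theorem exists_isGramInv {X : Matrix (Fin m) (Fin n) ℝ} {S : Finset (Fin n)}
    (h : 0 < (gram X S).det) : ∃ Y, IsGramInv X S Y :=
  ⟨(gram X S)⁻¹, nonsing_inv_mul _ (isUnit_iff_ne_zero.2 h.ne')⟩

namespace IsGramInv

variable {X : Matrix (Fin m) (Fin n) ℝ} {S : Finset (Fin n)} {Y : Matrix (Fin m) (Fin m) ℝ}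

theorem eq_inv (h : IsGramInv X S Y) : Y = (gram X S)⁻¹ :=
  (inv_eq_left_inv h).symm

theorem det_pos (h : IsGramInv X S Y) : 0 < (gram X S).det := by
  refine lt_of_le_of_ne (gram_posSemidef X S).det_nonneg fun h0 => ?_
  have := congrArg det h
  rw [det_mul, ← h0, mul_zero, det_one] at this
  exact zero_ne_one this

theorem posSemidef (h : IsGramInv X S Y) : Y.PosSemidef :=
  h.eq_inv ▸ (gram_posSemidef X S).inv

theorem symm (h : IsGramInv X S Y) : Yᵀ = Y := by
  simpa using h.posSemidef.1.eq

theorem cross_self_nonneg (h : IsGramInv X S Y) (j : Fin n) : 0 ≤ cross X Y j j := by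
  exact h.posSemidef.dotProduct_mulVec_nonneg (Xᵀ j)

theorem trace_mul_gram (Y : Matrix (Fin m) (Fin m) ℝ) (T : Finset (Fin n)) :
    (Y * gram X T).trace = ∑ j ∈ T, cross X Y j j := by
  simp [gram, Matrix.mul_sum, trace_sum, mul_vecMulVec, trace_vecMulVec, cross, dotProduct_comm]

/-- The sum is the trace of Y times the Gram matrix, that is, of the identity. All averaging
arguments below start from this value. -/
theorem sum_cross_self (h : IsGramInv X S Y) : ∑ j ∈ S, cross X Y j j = m := by
  rw [← trace_mul_gram, h]; simp

theorem sum_cross_self_nonneg (h : IsGramInv X S Y) (T : Finset (Fin n)) :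
    0 ≤ ∑ j ∈ T, cross X Y j j :=
  Finset.sum_nonneg fun j _ => h.cross_self_nonneg j

/-- Write Y = CᴴC. The positive semidefinite matrix C `gram X T` Cᴴ has trace ∑_{j ∈ T} l_j and
determinant det `gram X T` / det `gram X S`, so AM-GM applies. -/
theorem det_gram_le (h : IsGramInv X S Y) (hm : 1 ≤ m) (T : Finset (Fin n)) :
    (gram X T).det ≤ ((∑ j ∈ T, cross X Y j j) / m) ^ m * (gram X S).det := by
  obtain ⟨C, hC⟩ : ∃ C : Matrix (Fin m) (Fin m) ℝ, Y = Cᴴ * C := by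
    open scoped MatrixOrder in
    exact CStarAlgebra.nonneg_iff_eq_star_mul_self.mp h.posSemidef.nonneg
  have hP := (gram_posSemidef X T).mul_mul_conjTranspose_same C
  have hd := hP.det_le_trace_div_pow hm
  rw [trace_mul_comm, ← Matrix.mul_assoc, ← hC, trace_mul_gram, det_mul, det_mul,
    mul_right_comm, ← det_mul,
    mul_comm] at hd
  have h1 : (gram X S).det * (C * Cᴴ).det = 1 := by
    rw [det_mul, mul_comm C.det, ← det_mul, ← hC, mul_comm, ← det_mul, h, det_one]
  calc (gram X T).det = (gram X T).det * (C * Cᴴ).det * (gram X S).det := by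
        rw [mul_assoc, mul_comm (det (C * _)), h1, mul_one]
    _ ≤ _ := mul_le_mul_of_nonneg_right hd h.det_pos.le

theorem det_gram_insert (h : IsGramInv X S Y) {s : Fin n} (hs : s ∉ S) :
    (gram X (insert s S)).det = (gram X S).det * (1 + cross X Y s s) := by
  rw [gram_insert X hs, det_rankOne h, one_mul]; rfl

theorem det_gram_erase (h : IsGramInv X S Y) {r : Fin n} (hr : r ∈ S) :
    (gram X (S.erase r)).det = (gram X S).det * (1 - cross X Y r r) := by
  rw [gram_erase X hr, det_rankOne h, neg_one_mul, ← sub_eq_add_neg]; rfl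

/-- Otherwise the determinant left after erasing r would be negative. -/
theorem cross_self_le_one (h : IsGramInv X S Y) {r : Fin n} (hr : r ∈ S) : cross X Y r r ≤ 1 := by
  have h1 := (gram_posSemidef X (S.erase r)).det_nonneg
  rw [h.det_gram_erase hr] at h1
  have := nonneg_of_mul_nonneg_right h1 h.det_pos
  linarith

theorem insert_col (h : IsGramInv X S Y) {s : Fin n} (hs : s ∉ S) :
    IsGramInv X (insert s S)
      (Y - (1 / (1 + cross X Y s s)) • vecMulVec (Y *ᵥ Xᵀ s) (Y *ᵥ Xᵀ s)) := by
  have h0 := h.cross_self_nonneg s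
  have := rankOne_mul_eq_one h.symm h (Xᵀ s) 1 (by
    rw [one_mul]; exact (add_pos_of_pos_of_nonneg one_pos h0).ne')
  rwa [one_mul, ← gram_insert X hs] at this

theorem erase_col (h : IsGramInv X S Y) {r : Fin n} (hr : r ∈ S) (hl : cross X Y r r ≠ 1) :
    IsGramInv X (S.erase r)
      (Y + (1 / (1 - cross X Y r r)) • vecMulVec (Y *ᵥ Xᵀ r) (Y *ᵥ Xᵀ r)) := by
  have := rankOne_mul_eq_one h.symm h (Xᵀ r) (-1) (by
    rw [neg_one_mul, ← sub_eq_add_neg]; exact sub_ne_zero.2 hl.symm)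
  rwa [neg_one_mul, ← gram_erase X hr, ← sub_eq_add_neg, neg_div, neg_smul, sub_neg_eq_add] at this

theorem cross_rankOne (hY : Yᵀ = Y) (t : ℝ) (s i j : Fin n) :
    cross X (Y + t • vecMulVec (Y *ᵥ Xᵀ s) (Y *ᵥ Xᵀ s)) i j
      = cross X Y i j + t * (cross X Y s i * cross X Y s j) := by
  rw [cross, add_mulVec, dotProduct_add, smul_mulVec, vecMulVec_mulVec, cross_comm X hY s i,
    cross_comm X hY s j]
  simp [cross, dotProduct_comm, mul_comm]

end IsGramInv

end LinearAlgebra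

/-! ### Volume bounds from averaging leverages -/

section Greedy

variable {m n : ℕ} {X : Matrix (Fin m) (Fin n) ℝ} {S T : Finset (Fin n)}
  {Y : Matrix (Fin m) (Fin m) ℝ}

namespace IsGramInv

theorem card_mul_cross_self_le (h : IsGramInv X S Y) {r : Fin n}
    (hmin : ∀ j ∈ S, cross X Y r r ≤ cross X Y j j) : S.card * cross X Y r r ≤ m := by
  rw [← h.sum_cross_self, ← nsmul_eq_mul]
  exact Finset.card_nsmul_le_sum _ _ _ hmin

theorem cross_self_lt_one (h : IsGramInv X S Y) {r : Fin n}
    (hmin : ∀ j ∈ S, cross X Y r r ≤ cross X Y j j) (hS : m < S.card) : cross X Y r r < 1 := by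
  by_contra! h1
  have h2 := h.card_mul_cross_self_le hmin
  have h3 : (m : ℝ) < S.card := by exact_mod_cast hS
  nlinarith

/-- Greedy removal loses at most the ratio of two binomial coefficients. -/
theorem det_mul_choose_le (h : IsGramInv X S Y) {r : Fin n} (hr : r ∈ S)
    (hmin : ∀ j ∈ S, cross X Y r r ≤ cross X Y j j) {p : ℕ} (hp : S.card = p + 1) (hm : m ≤ p) :
    (gram X S).det * p.choose m ≤ (gram X (S.erase r)).det * (p + 1).choose m := by
  have h2 := h.card_mul_cross_self_le hmin
  -- This says C(p,m)/C(p+1,m) = 1 - m/(p+1), which is the factor lost when the smallest leverage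
  -- equals the average m/(p+1).
  have hc : (p.choose m : ℝ) * (p + 1) = (p + 1).choose m * (p + 1 - m) := by
    have := Nat.choose_mul_succ_eq p m
    rw [← Nat.cast_inj (R := ℝ)] at this
    push_cast [Nat.cast_sub (show m ≤ p + 1 by omega)] at this
    exact this
  rw [h.det_gram_erase hr, mul_assoc]
  refine mul_le_mul_of_nonneg_left ?_ h.det_pos.le
  have hp0 : (0 : ℝ) < p + 1 := by positivity
  rw [hp] at h2
  push_cast at h2
  refine le_of_mul_le_mul_right ?_ hp0
  rw [hc, mul_right_comm, mul_comm]
  exact mul_le_mul_of_nonneg_right (by linarith) (Nat.cast_nonneg _)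

theorem det_gram_le_of_cross_self_le (h : IsGramInv X S Y) (hm : 1 ≤ m) {c : ℝ}
    (hc : ∀ j, cross X Y j j ≤ c) (T : Finset (Fin n)) :
    (gram X T).det ≤ (c * T.card / m) ^ m * (gram X S).det := by
  refine (h.det_gram_le hm T).trans (mul_le_mul_of_nonneg_right ?_ h.det_pos.le)
  refine pow_le_pow_left₀ (div_nonneg (h.sum_cross_self_nonneg T) (Nat.cast_nonneg m)) ?_ m
  gcongr
  rw [mul_comm, ← nsmul_eq_mul]
  exact Finset.sum_le_card_nsmul _ _ _ fun j _ => hc j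

/-- The columns of T inside S contribute at most the full sum m, and each of the others at most c.
-/
theorem det_gram_le_of_cross_self_le_compl (h : IsGramInv X S Y) (hm : 1 ≤ m) {c : ℝ} (hc0 : 0 ≤ c)
    (hc : ∀ j ∉ S, cross X Y j j ≤ c) (T : Finset (Fin n)) :
    (gram X T).det ≤ ((m + T.card * c) / m) ^ m * (gram X S).det := by
  refine (h.det_gram_le hm T).trans (mul_le_mul_of_nonneg_right ?_ h.det_pos.le)
  refine pow_le_pow_left₀ (div_nonneg (h.sum_cross_self_nonneg T) (Nat.cast_nonneg m)) ?_ m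
  gcongr
  rw [← Finset.sum_inter_add_sum_sdiff T S, ← h.sum_cross_self]
  refine add_le_add ?_ ?_
  · exact Finset.sum_le_sum_of_subset_of_nonneg Finset.inter_subset_right
      fun j _ _ => h.cross_self_nonneg j
  · refine (Finset.sum_le_card_nsmul _ _ c fun j hj => hc j (Finset.mem_sdiff.1 hj).2).trans ?_
    rw [nsmul_eq_mul]
    gcongr
    exact Finset.sdiff_subset

/-- Let L be the leverage of s. After the insertion, the leverages of the 2m columns sum to m and
that of s is L/(1+L), so the smallest one l'_r in S is at most (m - L/(1+L))/(2m-1). Substituting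
this into the stopping test leaves an inequality in L alone, and the right-hand side 1 + 2m/(2m-1)
is the value for which it reads L ≤ 3. -/
theorem cross_self_le_three (h : IsGramInv X S Y) {s r : Fin n} (hs : s ∉ S)
    (hmax : ∀ j ∉ S, cross X Y j j ≤ cross X Y s s) {l' : Fin n → ℝ}
    (hl' : ∀ j, l' j = cross X Y j j - cross X Y s j ^ 2 / (1 + cross X Y s s))
    (hmin : ∀ j ∈ S, l' r ≤ l' j) (hm : 1 ≤ m) (hS : S.card = 2 * m - 1)
    (hexit : (1 + cross X Y s s) * (1 - l' r) ≤ 1 + 2 * (m : ℝ) / (2 * (m : ℝ) - 1)) (j : Fin n) :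
    cross X Y j j ≤ 3 := by
  have hm' : (1 : ℝ) ≤ m := by exact_mod_cast hm
  have hS' : (S.card : ℝ) = 2 * m - 1 := by
    rw [hS, Nat.cast_sub (by omega)]; push_cast; ring
  by_cases hj : j ∈ S
  · linarith [h.cross_self_le_one hj]
  refine (hmax j hj).trans ?_
  have h0 := h.cross_self_nonneg s
  have hsum := (h.insert_col hs).sum_cross_self
  have hl2 : ∀ j, cross X (Y - (1 / (1 + cross X Y s s)) • vecMulVec (Y *ᵥ Xᵀ s) (Y *ᵥ Xᵀ s)) j j
      = l' j := fun j => by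
    rw [sub_eq_add_neg, ← neg_smul, cross_rankOne h.symm, hl']; ring
  simp only [hl2] at hsum
  rw [Finset.sum_insert hs] at hsum
  have h1 : (S.card : ℝ) * l' r ≤ ∑ j ∈ S, l' j := by
    rw [← nsmul_eq_mul]
    exact Finset.card_nsmul_le_sum _ _ _ hmin
  have h2 := hl' s
  rw [hS'] at h1
  generalize cross X Y s s = L at *
  have hL : 0 < 1 + L := by linarith
  have hq : (0 : ℝ) < 2 * m - 1 := by linarith
  have h3 : (1 + L) * l' s = L := by
    rw [h2]; field_simp; ring
  have h4 : (1 + L) * ((2 * m - 1) * (1 - l' r)) ≤ 2 * m - 1 + 2 * m := by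
    calc _ = (2 * m - 1) * ((1 + L) * (1 - l' r)) := by ring
      _ ≤ (2 * m - 1) * (1 + 2 * m / (2 * m - 1)) := by gcongr
      _ = _ := by field_simp
  have h5 : (1 + L) * ((2 * m - 1) * l' r) ≤ (1 + L) * (m - l' s) :=
    mul_le_mul_of_nonneg_left (by linarith) hL.le
  -- Adding `h4` and `h5` and using `h3` gives mL + m - 1 ≤ 4m - 1.
  nlinarith

/-- Let q = |S|, k = |T|, and let L be the largest leverage outside S. If L ≥ 2m/q, the gain 1 + L
pays for the growth (1 + 1/q)^m of the required bound. If L < 2m/q, no gain is needed: AM-GM already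
makes S so good, compared with T, that the stronger bound with q + 1 holds for S itself. -/
theorem det_insert_ge (h : IsGramInv X S Y) {s : Fin n} (hs : s ∉ S)
    (hmax : ∀ j ∉ S, cross X Y j j ≤ cross X Y s s) (hm : 1 ≤ m) (hS : m ≤ S.card)
    (hT : S.card < T.card)
    (hST : ((S.card : ℝ) / (6 * T.card)) ^ m * (gram X T).det ≤ (gram X S).det) :
    (((S.card + 1 : ℕ) : ℝ) / (6 * T.card)) ^ m * (gram X T).det ≤ (gram X (insert s S)).det := by
  rw [h.det_gram_insert hs]
  have hm' : (0 : ℝ) < m := by exact_mod_cast hm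
  have hq1 : (1 : ℝ) ≤ S.card := by exact_mod_cast hm.trans hS
  have hqm : (m : ℝ) ≤ S.card := by exact_mod_cast hS
  have hkq : (S.card : ℝ) ≤ T.card := by exact_mod_cast hT.le
  have hd := h.det_pos
  have h0 := h.cross_self_nonneg s
  have hT0 := (gram_posSemidef X T).det_nonneg
  have hA := h.det_gram_le_of_cross_self_le_compl hm h0 hmax T
  push_cast
  generalize (S.card : ℝ) = q, (T.card : ℝ) = k, cross X Y s s = L, (gram X T).det = t,
    (gram X S).det = d at *
  have hq : 0 < q := by linarith
  have hk : 0 < k := by linarith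
  rcases le_or_gt (2 * (m / q)) L with hL | hL
  · have ht : |(m : ℝ) / q| ≤ 1 := by
      rw [abs_of_nonneg (by positivity)]
      exact div_le_one_of_le₀ hqm hq.le
    -- With x = m/q ≤ 1, the chain is (1 + 1/q)^m ≤ e^x ≤ 1 + x + x² ≤ 1 + 2x ≤ 1 + L.
    have h1 : (1 + 1 / q) ^ m ≤ 1 + L :=
      calc (1 + 1 / q) ^ m ≤ Real.exp (1 / q) ^ m := by
            gcongr
            rw [add_comm]
            exact Real.add_one_le_exp _
        _ = Real.exp (m / q) := by rw [← Real.exp_nat_mul, mul_one_div]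
        _ ≤ 1 + L := by
            have h2 := (abs_le.1 (Real.abs_exp_sub_one_sub_id_le ht)).2
            rw [abs_of_nonneg (by positivity)] at ht
            have h3 : (0 : ℝ) ≤ m / q := by positivity
            nlinarith
    calc ((q + 1) / (6 * k)) ^ m * t = (1 + 1 / q) ^ m * ((q / (6 * k)) ^ m * t) := by
          rw [← mul_assoc, ← mul_pow]
          congr 2
          field_simp
      _ ≤ (1 + L) * d := by gcongr
      _ = _ := mul_comm _ _
  · calc ((q + 1) / (6 * k)) ^ m * t
        ≤ ((q + 1) / (6 * k)) ^ m * (((m + k * L) / m) ^ m * d) := by gcongr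
      -- From L < 2m/q and q ≤ k: m + kL ≤ m + 2km/q ≤ 3km/q.
      _ ≤ ((q + 1) / (6 * k)) ^ m * ((3 * k / q) ^ m * d) := by
          gcongr ?_ * (?_ ^ m * _)
          rw [div_le_div_iff₀ hm' hq]
          rw [← mul_div_assoc, lt_div_iff₀ hq] at hL
          nlinarith
      _ = ((q + 1) / (2 * q)) ^ m * d := by
          rw [← mul_assoc, ← mul_pow]
          congr 2
          field_simp
          ring
      _ ≤ 1 ^ m * d := by
          gcongr
          rw [div_le_one (by positivity)]
          linarith
      _ ≤ d * (1 + L) := by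
          rw [one_pow, one_mul]
          exact le_mul_of_one_le_right hd.le (by linarith)

end IsGramInv

/-- Erase a column of smallest leverage until m columns remain; the losses telescope to the binomial
coefficient. This replaces the Cauchy-Binet formula. -/
theorem exists_det_gram_le_choose (X : Matrix (Fin m) (Fin n) ℝ) (T : Finset (Fin n)) (p : ℕ)
    (hT : T.card = m + p) :
    ∃ J ⊆ T, J.card = m ∧ (gram X T).det ≤ T.card.choose m * (gram X J).det := by
  by_cases h0 : (gram X T).det = 0
  · obtain ⟨J, hJ, hc⟩ := Finset.exists_subset_card_eq (show m ≤ T.card by omega)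
    refine ⟨J, hJ, hc, h0 ▸ mul_nonneg (Nat.cast_nonneg _) (gram_posSemidef X J).det_nonneg⟩
  have hpos := lt_of_le_of_ne (gram_posSemidef X T).det_nonneg (Ne.symm h0)
  induction p generalizing T with
  | zero => exact ⟨T, subset_rfl, hT, by simp [hT]⟩
  | succ p ih =>
    obtain ⟨Y, hY⟩ := exists_isGramInv hpos
    obtain ⟨r, hr, hmin⟩ := T.exists_min_image (fun j => cross X Y j j)
      (Finset.card_pos.1 (by omega))
    have h1 := hY.det_mul_choose_le hr hmin (p := m + p) hT (by omega)
    have hc0 : (0 : ℝ) < (m + p).choose m := by exact_mod_cast Nat.choose_pos (by omega)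
    have hc1 : (0 : ℝ) < (m + p + 1).choose m := by exact_mod_cast Nat.choose_pos (by omega)
    have hpos' : 0 < (gram X (T.erase r)).det := by
      refine pos_of_mul_pos_left (lt_of_lt_of_le (mul_pos hpos hc0) h1) hc1.le
    have hcard : (T.erase r).card = m + p := by rw [Finset.card_erase_of_mem hr]; omega
    obtain ⟨J, hJ, hJc, hle⟩ := ih (T.erase r) hcard hpos'.ne' hpos'
    refine ⟨J, hJ.trans (Finset.erase_subset _ _), hJc, ?_⟩
    rw [hcard] at hle
    rw [hT, ← add_assoc]
    refine le_of_mul_le_mul_right (h1.trans ?_) hc0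
    calc _ ≤ (m + p).choose m * (gram X J).det * (m + p + 1).choose m := by gcongr
      _ = _ := by ring

end Greedy

theorem foldl_finRange_induction {σ : Type*} {m : ℕ} (f : σ → Fin m → σ) (P : ℕ → σ → Prop)
    (a : σ) (h0 : P 0 a) (hs : ∀ (t : Fin m) (a : σ), P t a → P (t + 1) (f a t)) :
    P m ((List.finRange m).foldl f a) := by
  have key : ∀ k ≤ m, P k (((List.finRange m).take k).foldl f a) := by
    intro k
    induction k with
    | zero => simpa using h0
    | succ k ih =>
      intro hk
      have hk' : k < (List.finRange m).length := by simpa using hk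
      rw [← List.take_concat_get' _ _ hk', List.foldl_append]
      simpa using hs ⟨k, hk⟩ _ (ih (by omega))
  simpa [List.take_of_length_le] using key m le_rfl

/-! ### Correctness and cost of inversion, rank-one updates and LQ -/

section Subroutines

variable {m n : ℕ}

@[simp] theorem eval_applyP (X : Matrix (Fin m) (Fin n) ℝ) (Y : Fin m → Fin m → ℝ) (s : Fin n) :
    (applyP X Y s).eval = of Y *ᵥ Xᵀ s := by
  simp only [applyP, eval_tabulate, eval_dotP]; rfl

@[simp] theorem eval_againstP (X : Matrix (Fin m) (Fin n) ℝ) (y : Fin m → ℝ) :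
    (againstP X y).eval = fun j => y ⬝ᵥ Xᵀ j := by
  simp only [againstP, eval_tabulate, eval_dotP]; rfl

@[simp] theorem eval_lessSqP (l w : Fin n → ℝ) (d : ℝ) :
    (lessSqP l w d).eval = fun j => l j - w j * w j / d := by
  simp [lessSqP]

@[simp] theorem eval_plusSqP (l w : Fin n → ℝ) (d : ℝ) :
    (plusSqP l w d).eval = fun j => l j + w j * w j / d := by
  simp [plusSqP]

@[simp] theorem eval_lessRankOneP (Y : Fin m → Fin m → ℝ) (y : Fin m → ℝ) (d : ℝ) :
    (lessRankOneP Y y d).eval = of.symm (of Y - (1 / d) • vecMulVec y y) := by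
  funext a b
  simp [lessRankOneP, vecMulVec_apply, div_eq_inv_mul]

@[simp] theorem eval_plusRankOneP (Y : Fin m → Fin m → ℝ) (y : Fin m → ℝ) (d : ℝ) :
    (plusRankOneP Y y d).eval = of.symm (of Y + (1 / d) • vecMulVec y y) := by
  funext a b
  simp [plusRankOneP, vecMulVec_apply, div_eq_inv_mul]

theorem cost_applyP (X : Fin m → Fin n → ℝ) (Y : Fin m → Fin m → ℝ) (s : Fin n) :
    (applyP X Y s).cost ≤ m * (1 + 2 * m) :=
  cost_tabulate_le fun _ => cost_dotP _ _

theorem cost_againstP (X : Fin m → Fin n → ℝ) (y : Fin m → ℝ) :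
    (againstP X y).cost ≤ n * (1 + 2 * m) :=
  cost_tabulate_le fun _ => cost_dotP _ _

theorem cost_lessSqP (l w : Fin n → ℝ) (d : ℝ) : (lessSqP l w d).cost ≤ n * 3 :=
  cost_tabulate_le fun _ => by simp

theorem cost_plusSqP (l w : Fin n → ℝ) (d : ℝ) : (plusSqP l w d).cost ≤ n * 3 :=
  cost_tabulate_le fun _ => by simp

theorem cost_lessRankOneP (Y : Fin m → Fin m → ℝ) (y : Fin m → ℝ) (d : ℝ) :
    (lessRankOneP Y y d).cost ≤ m * (m * 3) :=
  cost_tabulate₂_le fun _ _ => by simp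

theorem cost_plusRankOneP (Y : Fin m → Fin m → ℝ) (y : Fin m → ℝ) (d : ℝ) :
    (plusRankOneP Y y d).cost ≤ m * (m * 3) :=
  cost_tabulate₂_le fun _ _ => by simp

theorem eval_eliminateP (t : Fin m) (p : Fin m → ℝ) (A : Fin m → Fin m → ℝ) :
    (eliminateP t p A).eval =
      fun i => if i = t then (p t)⁻¹ • A t else A i - (p i / p t) • A t := by
  funext i j
  simp only [eliminateP, Prog.eval_bind, eval_tabulate, eval_divP, eval_tabulate₂]
  split_ifs with h
  · simp [div_eq_inv_mul]
  · simp only [Prog.eval_bind, eval_mulP, eval_subP, Pi.sub_apply, Pi.smul_apply, smul_eq_mul]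
    ring

theorem cost_eliminateP (t : Fin m) (p : Fin m → ℝ) (A : Fin m → Fin m → ℝ) :
    (eliminateP t p A).cost ≤ m + m * (m * 2) := by
  simp only [eliminateP, Prog.cost_bind]
  refine add_le_add ?_ (cost_tabulate₂_le fun i j => ?_)
  · simpa using cost_tabulate_le (f := fun j => divP (A t j) (p t)) (B := 1) (by simp)
  · split_ifs <;> simp

/-- With the multipliers `p` fixed, elimination is a row operation and so commutes with
multiplication from the right. -/
theorem eliminateP_mul (t : Fin m) (p : Fin m → ℝ) {A B M : Matrix (Fin m) (Fin m) ℝ}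
    (h : B * M = A) : (of (eliminateP t p B).eval) * M = of (eliminateP t p A).eval := by
  subst h
  ext i j
  rw [Matrix.mul_apply']
  erw [eval_eliminateP, eval_eliminateP]
  change (if i = t then (p t)⁻¹ • B t else B i - (p i / p t) • B t) ⬝ᵥ (fun k => M k j) =
    (if i = t then (p t)⁻¹ • (B * M) t else (B * M) i - (p i / p t) • (B * M) t) j
  split_ifs
  · rw [smul_dotProduct]; rfl
  · rw [sub_dotProduct, smul_dotProduct]; rfl

/-- Gauss-Jordan elimination inverts a positive definite matrix. -/
theorem inverseP_mul {M : Matrix (Fin m) (Fin m) ℝ} (hM : M.PosDef) :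
    of (inverseP M).eval * M = 1 := by
  -- After t steps, B M = A, the first t columns of A are reduced, and the remaining columns of B
  -- are still untouched. The last clause serves only to show that the pivots do not vanish.
  let P : ℕ → (Fin m → Fin m → ℝ) × (Fin m → Fin m → ℝ) → Prop := fun t AB =>
    of AB.2 * M = of AB.1 ∧
      (∀ i j : Fin m, (j : ℕ) < t → AB.1 i j = if i = j then 1 else 0) ∧
      (∀ i j : Fin m, t ≤ (j : ℕ) → AB.2 i j = if i = j then 1 else 0)
  have key := foldl_finRange_induction (m := m)
    (fun (AB : (Fin m → Fin m → ℝ) × (Fin m → Fin m → ℝ)) t =>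
      ((eliminateP t (fun i => AB.1 i t) AB.1).eval, (eliminateP t (fun i => AB.1 i t) AB.2).eval))
    P (M, fun i j => if i = j then 1 else 0) ?_ ?_
  · obtain ⟨h1, h2, -⟩ := key
    have heval : (inverseP M).eval = ((List.finRange m).foldl
      (fun (AB : (Fin m → Fin m → ℝ) × (Fin m → Fin m → ℝ)) t =>
        ((eliminateP t (fun i => AB.1 i t) AB.1).eval,
          (eliminateP t (fun i => AB.1 i t) AB.2).eval))
      (M, fun i j => if i = j then 1 else 0)).2 := by
      simp [inverseP, Prog.eval_foldlM]
    rw [heval, h1]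
    ext i j
    rw [of_apply, h2 i j j.2, one_apply]
  · refine ⟨?_, by simp, fun i j _ => rfl⟩
    have : (of fun i j : Fin m => if i = j then (1 : ℝ) else 0) = 1 := by
      ext i j; simp [one_apply]
    rw [this, Matrix.one_mul]; rfl
  · rintro t ⟨A, B⟩ ⟨h1, h2, h3⟩
    simp only at h1 h2 h3
    -- No pivoting is needed. Let b be row t of B, which is nonzero since its entry t is 1. Row t of
    -- A is bM, and it vanishes left of t, while b vanishes right of t. A zero pivot would give b M
    -- bᵀ = 0, against definiteness.
    have hp : A t t ≠ 0 := by
      intro hp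
      have hB : B t ≠ 0 := fun h => by
        have := h3 t t le_rfl
        rw [h] at this
        simp at this
      have hpos := hM.dotProduct_mulVec_pos hB
      have : star (B t) ⬝ᵥ M *ᵥ B t = 0 := by
        rw [star_trivial, dotProduct_mulVec]
        have hA : B t ᵥ* M = A t := funext fun j => congrFun (congrFun h1 t) j
        rw [hA]
        refine Finset.sum_eq_zero fun j _ => ?_
        rcases lt_trichotomy j t with hj | rfl | hj
        · rw [h2 t j hj, if_neg hj.ne', zero_mul]
        · rw [hp, zero_mul]
        · rw [h3 t j hj.le, if_neg hj.ne, mul_zero]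
      exact hpos.ne' this
    refine ⟨eliminateP_mul t _ h1, fun i j hj => ?_, fun i j hj => ?_⟩
    · simp only
      rw [eval_eliminateP]
      rcases (Nat.lt_succ_iff.1 hj).lt_or_eq with hj | hj
      · have h4 : A t j = 0 := by rw [h2 t j hj, if_neg (Fin.ne_of_gt hj)]
        by_cases h5 : i = t
        · subst h5
          simp [h4, (Fin.ne_of_lt hj).symm]
        · simp [h5, h4, h2 i j hj]
      · obtain rfl := Fin.ext hj
        by_cases h5 : i = j
        · subst h5
          simp [hp]
        · simp [h5, hp]
    · simp only
      rw [eval_eliminateP]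
      have hj' : t < j := Nat.lt_of_succ_le hj
      have h4 : B t j = 0 := by rw [h3 t j hj'.le, if_neg hj'.ne]
      have h5 := h3 i j hj'.le
      by_cases h6 : i = t
      · subst h6
        simp [h4, hj'.ne]
      · simp [h6, h4, h5]

theorem cost_inverseP (M : Fin m → Fin m → ℝ) :
    (inverseP M).cost ≤ 2 + m * (2 * (m + m * (m * 2))) := by
  simp only [inverseP, Prog.cost_bind, Prog.cost_pure, cost_constP, add_zero, ← add_assoc]
  refine add_le_add le_rfl ((Prog.cost_foldlM_le _ (2 * (m + m * (m * 2))) ?_ _ _).trans_eq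
    (by rw [List.length_finRange]))
  intro a i
  simp only [Prog.cost_bind, Prog.cost_pure, add_zero]
  have := cost_eliminateP i (fun j => a.1 j i) a.1
  have := cost_eliminateP i (fun j => a.1 j i) a.2
  omega

theorem isGramInv_gramInverseP {X : Matrix (Fin m) (Fin n) ℝ} {S : Finset (Fin n)}
    (h : 0 < (gram X S).det) : IsGramInv X S (of (gramInverseP X S).eval) := by
  have heval : (gramInverseP X S).eval = (inverseP (gram X S)).eval := by
    simp only [gramInverseP, Prog.eval_bind, eval_tabulate₂, eval_sumP_filter, eval_mulP]
    congr 2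
    funext a b
    rw [gram_apply]
  rw [heval]
  exact inverseP_mul ((gram_posSemidef X S).posDef_iff_det_ne_zero.2 h.ne')

/-- The m³ operations of the inversion are absorbed by the m²|S| operations of forming the Gram
matrix. -/
theorem cost_gramInverseP (X : Fin m → Fin n → ℝ) {S : Finset (Fin n)} (hm : 1 ≤ m)
    (hS : m ≤ S.card) : (gramInverseP X S).cost ≤ 11 * (m * m * S.card) := by
  simp only [gramInverseP, Prog.cost_bind]
  refine (add_le_add (cost_tabulate₂_le (B := 1 + S.card * 2) fun a b => ?_)
    (cost_inverseP _)).trans ?_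
  · refine (cost_sumP_le _ (B := 1) (by simp)).trans_eq ?_
    rw [length_filter_finRange]
  · generalize S.card = q at *
    have h1 : m * m * m ≤ m * m * q := Nat.mul_le_mul_left _ hS
    have h2 : m * m * 1 ≤ m * m * q := Nat.mul_le_mul_left _ (hm.trans hS)
    have h3 : 1 * 1 ≤ m * m := Nat.mul_le_mul hm hm
    nlinarith

/-- The data of a state belong to its set of columns. -/
structure SplitState.Valid (X : Matrix (Fin m) (Fin n) ℝ) (st : SplitState ℝ m n) : Prop where
  inv : IsGramInv X st.S (of st.Y)
  lev : ∀ j, st.l j = cross X (of st.Y) j j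

theorem splitInit_S (X : Matrix (Fin m) (Fin n) ℝ) (S : Finset (Fin n)) :
    (splitInit X S).eval.S = S := by
  simp [splitInit]

theorem splitInit_valid {X : Matrix (Fin m) (Fin n) ℝ} {S : Finset (Fin n)}
    (h : 0 < (gram X S).det) : (splitInit X S).eval.Valid X := by
  simp only [splitInit, Prog.eval_bind, Prog.eval_pure, eval_tabulate, eval_dotP]
  refine ⟨isGramInv_gramInverseP h, fun j => ?_⟩
  simp only [eval_applyP]
  exact dotProduct_comm _ _

theorem cost_splitInit (X : Fin m → Fin n → ℝ) {S : Finset (Fin n)} (hm : 1 ≤ m)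
    (hS : m ≤ S.card) : (splitInit X S).cost ≤ 17 * (n * m ^ 2) := by
  have h1 := cost_gramInverseP X hm hS
  have h2 : m * m * S.card ≤ m * m * n := Nat.mul_le_mul_left _ (by simpa using S.card_le_univ)
  have h3 : (tabulate n fun j => do
      let y ← applyP X (gramInverseP X S).eval j
      dotP y fun a => X a j).cost ≤ n * (m * (1 + 2 * m) + (1 + 2 * m)) :=
    cost_tabulate_le fun j => by
      rw [Prog.cost_bind]
      exact add_le_add (cost_applyP _ _ _) (cost_dotP _ _)
  simp only [splitInit, Prog.cost_bind, Prog.cost_pure, add_zero]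
  refine (add_le_add h1 h3).trans ?_
  have h4 : n * (m * (1 + 2 * m) + (1 + 2 * m)) ≤ n * (6 * (m * m)) :=
    Nat.mul_le_mul_left _ (by nlinarith)
  nlinarith

/-- One Gram-Schmidt step is multiplication by a lower triangular matrix with diagonal entries a and
1. -/
theorem lqP_step_eq_mul (Q : Matrix (Fin m) (Fin n) ℝ) (t : Fin m) (ht : Q t ≠ 0)
    {Q' : Matrix (Fin m) (Fin n) ℝ} (c : Fin m → ℝ) {a : ℝ} (ha : a ≠ 0)
    (hQ' : ∀ i, Q' i = if i = t then a • Q t else if t < i then Q i - c i • Q t else Q i) :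
    ∃ F : Matrix (Fin m) (Fin m) ℝ, F.det ≠ 0 ∧ Q' = F * Q := by
  let F : Matrix (Fin m) (Fin m) ℝ := fun i =>
    if i = t then Pi.single t a else if t < i then Pi.single i 1 - Pi.single t (c i)
      else Pi.single i 1
  refine ⟨F, ?_, ?_⟩
  · rw [det_of_isLowerTriangular]
    · refine Finset.prod_ne_zero_iff.2 fun i _ => ?_
      simp only [F]
      split_ifs with h1 h2
      · subst h1; simpa using ha
      · simp [h1]
      · simp
    · intro i j hij
      have hij : i < j := hij
      simp only [F]
      split_ifs with h1 h2
      · subst h1; simp [hij.ne']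
      · simp [hij.ne', (h2.trans hij).ne']
      · simp [hij.ne']
  · ext i j
    rw [Matrix.mul_apply', hQ' i]
    simp only [F]
    split_ifs with h1 h2
    · simp
    · simp [sub_dotProduct]
    · simp

/-- The preprocessing step multiplies `X` by an invertible matrix. -/
theorem exists_eval_splitPrep_eq_mul (lq : Bool) {X : Matrix (Fin m) (Fin n) ℝ}
    (hX : ∀ v, v ᵥ* X = 0 → v = 0) :
    ∃ A : Matrix (Fin m) (Fin m) ℝ, A.det ≠ 0 ∧ (splitPrep lq X).eval = A * X := by
  cases lq with
  | false => exact ⟨1, by simp, (Matrix.one_mul X).symm⟩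
  | true =>
    simp only [splitPrep, lqP, if_true]
    -- Orthogonality of the rows plays no role; an invertible left factor is enough. It also keeps
    -- row t nonzero, so the normalization is legitimate.
    let P : ℕ → (Fin m → Fin n → ℝ) → Prop := fun _ Q =>
      ∃ A : Matrix (Fin m) (Fin m) ℝ, A.det ≠ 0 ∧ Q = A * X
    suffices h : ∀ (t : Fin m) Q, P t Q → P (t + 1) _ by
      obtain ⟨A, hA, h⟩ := foldl_finRange_induction _ P X ⟨1, by simp, (Matrix.one_mul X).symm⟩ h
      exact ⟨A, hA, (Prog.eval_foldlM _ _ _).trans h⟩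
    rintro t Q ⟨A, hA, rfl⟩
    have hQ : (A * X) t ≠ 0 := fun h =>
      hA (det_eq_zero_of_row_eq_zero t fun j => congrFun (hX (A t) h) j)
    have hsq : 0 < (A * X) t ⬝ᵥ (A * X) t := by
      simpa using dotProduct_star_self_pos_iff.2 hQ
    have hn := (Real.sqrt_pos.2 hsq).ne'
    obtain ⟨F, hF, hF'⟩ := lqP_step_eq_mul (A * X) t hQ
      (fun i => ((A * X) i ⬝ᵥ fun j => (A * X) t j / √((A * X) t ⬝ᵥ (A * X) t)) /
        √((A * X) t ⬝ᵥ (A * X) t)) (inv_ne_zero hn) (fun i => rfl)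
    refine ⟨F * A, by rw [det_mul]; exact mul_ne_zero hF hA, ?_⟩
    rw [Matrix.mul_assoc, ← hF']
    simp only [Prog.eval_bind, eval_dotP, eval_sqrtP, eval_tabulate, eval_divP]
    funext i
    split_ifs with h1 h2
    · subst h1
      funext j
      simp [div_eq_inv_mul]
    · funext j
      simp only [Prog.eval_bind, eval_dotP, eval_tabulate, eval_mulP, eval_subP, Pi.sub_apply,
        Pi.smul_apply, smul_eq_mul]
      ring
    · rfl

theorem cost_splitPrep (lq : Bool) (X : Fin m → Fin n → ℝ) (hm : 1 ≤ m) (hn : 1 ≤ n) :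
    (splitPrep lq X).cost ≤ 10 * (n * m ^ 2) := by
  cases lq with
  | false => simp [splitPrep]
  | true =>
    simp only [splitPrep, lqP, if_true]
    refine (Prog.cost_foldlM_le _ (10 * (m * n)) (fun Q t => ?_) _ _).trans_eq ?_
    · have h1 := cost_dotP (Q t) (Q t)
      simp only [Prog.cost_bind, eval_dotP, eval_sqrtP, eval_tabulate, eval_divP, cost_sqrtP]
      have h2 := cost_tabulate_le (f := fun j => divP (Q t j) √(Q t ⬝ᵥ Q t)) (B := 1) (by simp)
      refine (add_le_add h1 (add_le_add le_rfl (add_le_add h2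
        (cost_tabulate_le (B := 1 + 2 * n + n * 2) fun i => ?_)))).trans ?_
      · split_ifs
        · simp
        · rw [Prog.cost_bind]
          exact add_le_add (cost_dotP _ _) (cost_tabulate_le fun j => by simp)
        · simp
      · nlinarith [Nat.mul_le_mul hm hn, Nat.mul_le_mul hm (le_refl n),
          Nat.mul_le_mul (le_refl m) hn]
    · rw [List.length_finRange]; ring

end Subroutines

/-! ### One pass of Dominant-split -/

section DominantSplit

variable {m n : ℕ} {X : Matrix (Fin m) (Fin n) ℝ}

theorem SplitState.Valid.lessSq {st : SplitState ℝ m n} (h : st.Valid X) {s : Fin n}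
    (hs : s ∉ st.S) :
    SplitState.Valid X ⟨insert s st.S,
      of.symm (of st.Y - (1 / (1 + st.l s)) • vecMulVec (of st.Y *ᵥ Xᵀ s) (of st.Y *ᵥ Xᵀ s)),
      fun j => st.l j - ((of st.Y *ᵥ Xᵀ s) ⬝ᵥ Xᵀ j) * ((of st.Y *ᵥ Xᵀ s) ⬝ᵥ Xᵀ j) /
        (1 + st.l s)⟩ where
  inv := h.lev s ▸ h.inv.insert_col hs
  lev j := by
    have h1 := IsGramInv.cross_rankOne (X := X) h.inv.symm (-(1 / (1 + st.l s))) s j j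
    rw [neg_smul, ← sub_eq_add_neg] at h1
    refine Eq.trans ?_ h1.symm
    simp only
    rw [dotProduct_mulVec_eq_cross, cross_comm X h.inv.symm j s, h.lev j]
    ring

theorem SplitState.Valid.plusSq {st : SplitState ℝ m n} (h : st.Valid X) {r : Fin n}
    (hr : r ∈ st.S) (hl : st.l r ≠ 1) :
    SplitState.Valid X ⟨st.S.erase r,
      of.symm (of st.Y + (1 / (1 - st.l r)) • vecMulVec (of st.Y *ᵥ Xᵀ r) (of st.Y *ᵥ Xᵀ r)),
      fun j => st.l j + ((of st.Y *ᵥ Xᵀ r) ⬝ᵥ Xᵀ j) * ((of st.Y *ᵥ Xᵀ r) ⬝ᵥ Xᵀ j) /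
        (1 - st.l r)⟩ where
  inv := h.lev r ▸ h.inv.erase_col hr (h.lev r ▸ hl)
  lev j := by
    have h1 := IsGramInv.cross_rankOne (X := X) h.inv.symm (1 / (1 - st.l r)) r j j
    refine Eq.trans ?_ h1.symm
    simp only
    rw [dotProduct_mulVec_eq_cross, cross_comm X h.inv.symm j r, h.lev j]
    ring

/-- What is known when the main loop is left. -/
def SplitStop (X : Matrix (Fin m) (Fin n) ℝ) (c : ℝ) (st : SplitState ℝ m n) : Prop :=
  st.S = Finset.univ ∨ st.S = ∅ ∨ ∃ s ∉ st.S, ∃ r : Fin n, ∃ l' : Fin n → ℝ,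
    (∀ j ∉ st.S, cross X (of st.Y) j j ≤ cross X (of st.Y) s s) ∧
    (∀ j, l' j = cross X (of st.Y) j j - cross X (of st.Y) s j ^ 2 / (1 + cross X (of st.Y) s s)) ∧
    (∀ j ∈ st.S, l' r ≤ l' j) ∧ (1 + cross X (of st.Y) s s) * (1 - l' r) ≤ c ^ 2

theorem splitBody_spec {st : SplitState ℝ m n} (h : st.Valid X) (c : ℝ)
    (eAdd eRem : Fin n ≃ Fin n) :
    ((splitBody X c eAdd eRem st).eval = Sum.inr st.S ∧ SplitStop X c st) ∨
    ∃ st', (splitBody X c eAdd eRem st).eval = Sum.inl st' ∧ st'.Valid X ∧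
      st'.S.card = st.S.card ∧ (gram X st.S).det * c ^ 2 ≤ (gram X st'.S).det := by
  unfold splitBody
  rw [Prog.eval_bind]
  rcases argmaxP_spec st.l (scan eAdd (· ∉ st.S)) with ⟨h1, h2⟩ | ⟨s, hs, h1, hmax⟩
  · left
    rw [h1]
    refine ⟨rfl, Or.inl (Finset.eq_univ_iff_forall.2 fun j => ?_)⟩
    by_contra hj
    exact List.ne_nil_of_mem ((mem_scan (p := (· ∉ st.S))).2 hj) h2
  rw [h1]
  replace hs : s ∉ st.S := (mem_scan (p := (· ∉ st.S))).1 hs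
  have hv' := h.lessSq hs
  simp only [Prog.eval_bind, eval_constP, eval_applyP, eval_againstP, eval_addP, eval_lessSqP,
    eval_lessRankOneP, Int.cast_one]
  have hl' : ∀ j, st.l j - ((of st.Y *ᵥ Xᵀ s) ⬝ᵥ Xᵀ j) * ((of st.Y *ᵥ Xᵀ s) ⬝ᵥ Xᵀ j) /
      (1 + st.l s) = cross X (of st.Y) j j -
        cross X (of st.Y) s j ^ 2 / (1 + cross X (of st.Y) s s) := fun j => by
    rw [dotProduct_mulVec_eq_cross, cross_comm X h.inv.symm j s, h.lev j, h.lev s, sq]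
  rcases argminP_spec (fun j => st.l j - ((of st.Y *ᵥ Xᵀ s) ⬝ᵥ Xᵀ j) *
    ((of st.Y *ᵥ Xᵀ s) ⬝ᵥ Xᵀ j) / (1 + st.l s)) (scan eRem fun x => x ∈ st.S)
    with ⟨h2, h3⟩ | ⟨r, hr, h2, hmin⟩
  · left
    rw [h2]
    refine ⟨rfl, Or.inr (Or.inl (Finset.eq_empty_iff_forall_notMem.2 fun j hj => ?_))⟩
    exact List.ne_nil_of_mem ((mem_scan (p := (· ∈ st.S))).2 hj) h3
  rw [h2]
  replace hr : r ∈ st.S := (mem_scan (p := (· ∈ st.S))).1 hr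
  have hrs : r ≠ s := fun h => hs (h ▸ hr)
  simp only [Prog.eval_bind, ↓Prog.eval_ite, eval_mulP, eval_subP, eval_leP]
  by_cases hc : (1 + st.l s) * (1 - (st.l r - ((of st.Y *ᵥ Xᵀ s) ⬝ᵥ Xᵀ r) *
      ((of st.Y *ᵥ Xᵀ s) ⬝ᵥ Xᵀ r) / (1 + st.l s))) ≤ c * c
  · left
    rw [decide_eq_true hc, cond_true]
    refine ⟨rfl, Or.inr (Or.inr ⟨s, hs, r, _, fun j hj => ?_, hl', fun j hj => ?_, ?_⟩)⟩
    · rw [← h.lev, ← h.lev]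
      exact hmax j ((mem_scan (p := (· ∉ st.S))).2 hj)
    · exact hmin j ((mem_scan (p := (· ∈ st.S))).2 hj)
    · rwa [← h.lev s, sq]
  · right
    rw [decide_eq_false hc, cond_false]
    simp only [eval_applyP, eval_againstP, eval_plusSqP, eval_plusRankOneP,
      Prog.eval_pure]
    have hd := hv'.inv.det_gram_erase (Finset.mem_insert_of_mem hr)
    rw [← hv'.lev r] at hd
    simp only at hd
    have hls := h.inv.det_gram_insert hs
    rw [← h.lev s] at hls
    have hpos := h.inv.det_pos
    have h0 := h.inv.cross_self_nonneg s
    rw [← h.lev s] at h0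
    refine ⟨_, rfl, hv'.plusSq (Finset.mem_insert_of_mem hr) fun he => ?_, ?_, ?_⟩
    -- The gain exceeds c² ≥ 0, so it is not zero and the division by 1 - l'_r is safe.
    · simp only at he
      rw [he, sub_self, mul_zero] at hc
      exact hc (mul_self_nonneg c)
    · simp [Finset.card_erase_of_mem (Finset.mem_insert_of_mem hr), hs]
    · simp only
      rw [hd, hls, mul_assoc, sq]
      exact mul_le_mul_of_nonneg_left (not_le.1 hc).le hpos.le

theorem cost_splitBody (X : Matrix (Fin m) (Fin n) ℝ) (c : ℝ) (eAdd eRem : Fin n ≃ Fin n)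
    (st : SplitState ℝ m n) (hm : 1 ≤ m) (hmn : m ≤ n) :
    (splitBody X c eAdd eRem st).cost ≤ 32 * (n * m) := by
  have h1 := (cost_argmaxP_le st.l _).trans (length_scan_le eAdd (· ∉ st.S))
  have h2 := fun l' => (cost_argminP_le l' _).trans (length_scan_le eRem (· ∈ st.S))
  unfold splitBody
  rw [Prog.cost_bind]
  rcases (argmaxP st.l (scan eAdd (· ∉ st.S))).eval with _ | s
  · simp only [Prog.cost_pure]
    nlinarith
  simp only [Prog.cost_bind]
  have h3 := cost_applyP X st.Y s
  have h4 := fun y => cost_againstP X y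
  have h5 := fun w d => cost_lessSqP (n := n) st.l w d
  have h6 := fun y d => cost_lessRankOneP (m := m) st.Y y d
  have hmm : m * (m * 3) ≤ n * m * 3 := by nlinarith
  have hmm' : m * (1 + 2 * m) ≤ n * m * 3 := by nlinarith
  have hnm : n * (1 + 2 * m) ≤ n * m * 3 := by nlinarith
  have hn : n ≤ n * m := Nat.le_mul_of_pos_right _ hm
  have hbound : ∀ o : Option (Fin n), ∀ f : Fin n → Prog ℝ (SplitState ℝ m n ⊕ Finset (Fin n)),
      (∀ r, (f r).cost ≤ 16 * (n * m)) →
      (match o with | none => pure (Sum.inr st.S) | some r => f r).cost ≤ 16 * (n * m) := by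
    rintro (_ | r) f hf
    · simp
    · exact hf r
  refine (add_le_add h1 (add_le_add (cost_constP 1).le (add_le_add h3 (add_le_add (h4 _)
    (add_le_add (cost_addP _ _).le (add_le_add (h5 _ _) (add_le_add (h6 _ _) (add_le_add (h2 _)
    (hbound _ _ fun r => (?_ : _ ≤ 4 + (n * m * 3 + n * m * 3 + n * 3 + n * m * 3))
      |>.trans ?_))))))))).trans ?_
  · simp only [Prog.cost_bind, cost_subP, cost_mulP, cost_leP]
    refine (add_le_add (le_refl 1) (add_le_add (le_refl 1) (add_le_add (le_refl 1)
      (add_le_add (le_refl 1) (Prog.cost_ite_le _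
        (B := n * m * 3 + n * m * 3 + n * 3 + n * m * 3) (by simp) ?_))))).trans (by omega)
    simp only [Prog.cost_bind, Prog.cost_pure]
    refine (add_le_add (cost_applyP X _ r) (add_le_add (h4 _) (add_le_add
        (cost_plusSqP (n := n) _ _ _) (add_le_add (cost_plusRankOneP (m := m) _ _ _)
          (le_refl 0))))).trans (by omega)
  · omega
  · omega

end DominantSplit

/-! ### Running Dominant-split to the end -/

section Termination

variable {m n : ℕ} {X : Matrix (Fin m) (Fin n) ℝ}

theorem splitLoop_spec {c : ℝ} {eAdd eRem : ℕ → (Fin n ≃ Fin n)} {i : ℕ} {st : SplitState ℝ m n}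
    {out : Finset (Fin n)} {t : ℕ}
    (h : Loop (fun i => splitBody X c (eAdd i) (eRem i)) i st out t) (hst : st.Valid X) :
    ∃ st' : SplitState ℝ m n, st'.Valid X ∧ st'.S = out ∧ st'.S.card = st.S.card ∧
      SplitStop X c st' := by
  induction h with
  | @exit i st out h =>
    rcases splitBody_spec hst c (eAdd i) (eRem i) with ⟨h1, h2⟩ | ⟨st', h1, -⟩
    · exact ⟨st, hst, Sum.inr.inj (h1.symm.trans h), rfl, h2⟩
    · exact absurd (h1.symm.trans h) (by simp)
  | @next i st st' out t h rest ih =>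
    rcases splitBody_spec hst c (eAdd i) (eRem i) with ⟨h1, -⟩ | ⟨st₁, h1, h2, h3, -⟩
    · exact absurd (h1.symm.trans h) (by simp)
    · obtain rfl := Sum.inl.inj (h1.symm.trans h)
      obtain ⟨st₂, h4, h5, h6, h7⟩ := ih h2
      exact ⟨st₂, h4, h5, h6.trans h3, h7⟩

theorem exists_splitStart_eval (lq : Bool) (hX : ∀ v, v ᵥ* X = 0 → v = 0) {S : Finset (Fin n)}
    (hS : 0 < (gram X S).det) :
    ∃ A : Matrix (Fin m) (Fin m) ℝ, A.det ≠ 0 ∧ (splitStart lq X S).eval.1 = A * X ∧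
      (splitStart lq X S).eval.2.Valid (A * X) ∧ (splitStart lq X S).eval.2.S = S := by
  obtain ⟨A, hA, h⟩ := exists_eval_splitPrep_eq_mul lq hX
  have h' : (splitStart lq X S).eval = (A * X, (splitInit (A * X) S).eval) := by
    simp only [splitStart, Prog.eval_bind, Prog.eval_pure, h]; rfl
  have hpos : 0 < (gram (A * X) S).det := by
    rw [det_gram_mul_left]; positivity
  rw [h']
  exact ⟨A, hA, rfl, splitInit_valid hpos, splitInit_S _ _⟩

theorem cost_splitStart (lq : Bool) (X : Matrix (Fin m) (Fin n) ℝ) {S : Finset (Fin n)}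
    (hm : 1 ≤ m) (hS : m ≤ S.card) : (splitStart lq X S).cost ≤ 27 * (n * m ^ 2) := by
  have hn : 1 ≤ n := hm.trans (hS.trans (by simpa using S.card_le_univ))
  have h1 := cost_splitPrep lq X hm hn
  have h2 := cost_splitInit (splitPrep lq X).eval hm hS
  simp only [splitStart, Prog.cost_bind, Prog.cost_pure]
  omega

/-- The potential is the squared volume in the coordinates after preprocessing: R caps its total
growth, and every exchange multiplies it by at least c². -/
theorem exists_dominantSplit (lq : Bool) (ties : SplitTies n) (hX : ∀ v, v ᵥ* X = 0 → v = 0)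
    {S : Finset (Fin n)} (hS : 0 < (gram X S).det) (hm : 1 ≤ m) (hmS : m ≤ S.card) {c R : ℝ}
    (hR : ∀ T : Finset (Fin n), T.card = S.card → (gram X T).det ≤ R * (gram X S).det)
    {N : ℕ} (hN : R < (c ^ 2) ^ (N + 1)) :
    ∃ (S' : Finset (Fin n)) (T : ℕ), DominantSplit lq ties X c S S' T ∧
      T ≤ 27 * (n * m ^ 2) + (N + 1) * (32 * (n * m)) := by
  obtain ⟨A, hA, h1, h2, h3⟩ := exists_splitStart_eval lq hX hS
  have hmn : m ≤ n := hmS.trans (by simpa using S.card_le_univ)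
  have hA2 : 0 < A.det ^ 2 := by positivity
  obtain ⟨S', t, hl, ht⟩ := Loop.exists_of_potential
    (body := fun i => splitBody (A * X) c (ties.eAdd i) (ties.eRem i))
    (fun st => st.Valid (A * X) ∧ st.S.card = S.card) (fun st => (gram (A * X) st.S).det)
    (M := A.det ^ 2 * (R * (gram X S).det)) (q := c ^ 2) (C := 32 * (n * m)) (sq_nonneg c)
    (fun st hst => by
      rw [det_gram_mul_left]
      exact mul_le_mul_of_nonneg_left (hR _ hst.2) hA2.le)
    (fun i st _ => cost_splitBody _ _ _ _ _ hm hmn)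
    (fun i st st' hst h => by
      rcases splitBody_spec hst.1 c (ties.eAdd i) (ties.eRem i) with ⟨h1, -⟩ | ⟨st₁, h1, h4, h5, h6⟩
      · exact absurd (h1.symm.trans h) (by simp)
      · obtain rfl := Sum.inl.inj (h1.symm.trans h)
        exact ⟨⟨h4, h5.trans hst.2⟩, h6⟩)
    N 0 (splitStart lq X S).eval.2 ⟨h2, by rw [h3]⟩ (by
      rw [h3, det_gram_mul_left, mul_assoc]
      refine mul_lt_mul_of_pos_left ?_ hA2
      rw [mul_comm]
      exact mul_lt_mul_of_pos_left hN hS)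
  refine ⟨S', _, ⟨t, ?_, rfl⟩, add_le_add (cost_splitStart lq X hm hmS) ht⟩
  rw [h1]
  exact hl

end Termination

/-! ### The pivots of column pivoted QR have full rank -/

section Initialization

variable {m n : ℕ} {X : Matrix (Fin m) (Fin n) ℝ}

theorem vecMul_eq_zero_of_rank_eq (h : X.rank = m) (v : Fin m → ℝ) (hv : v ᵥ* X = 0) : v = 0 := by
  have hli : LinearIndependent ℝ X.row := by
    rw [linearIndependent_iff_card_eq_finrank_span, Fintype.card_fin, Set.finrank,
      ← rank_eq_finrank_span_row, h]
  exact vecMul_injective_iff.2 hli (hv.trans (zero_vecMul X).symm)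

/-- The quadratic form of the Gram matrix at v is the sum of the squares (x_j · v)² over S. -/
theorem det_gram_pos {S : Finset (Fin n)} (h : ∀ v, (∀ j ∈ S, Xᵀ j ⬝ᵥ v = 0) → v = 0) :
    0 < (gram X S).det := by
  refine (PosDef.of_dotProduct_mulVec_pos (gram_posSemidef X S).1 fun v hv => ?_).det_pos
  have h1 : star v ⬝ᵥ (gram X S *ᵥ v) = ∑ j ∈ S, (Xᵀ j ⬝ᵥ v) ^ 2 := by
    rw [star_trivial, gram, sum_mulVec, dotProduct_sum]
    refine Finset.sum_congr rfl fun j _ => ?_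
    rw [vecMulVec_mulVec, dotProduct_comm v]
    simp [sq]
  rw [h1]
  refine lt_of_le_of_ne (Finset.sum_nonneg fun j _ => sq_nonneg _) fun h0 => hv (h v fun j hj => ?_)
  simpa using (Finset.sum_eq_zero_iff_of_nonneg fun j _ => sq_nonneg _).1 h0.symm j hj

/-- If some pivot has zero residual, maximality makes all residuals zero at that stage. Otherwise
each pivot raises the dimension of the span, and m pivots fill the whole space. -/
theorem IsCPQR.column_mem_span {p : Fin m → Fin n} (hp : IsCPQR X p) (j : Fin n) :
    column X j ∈ Submodule.span ℝ (Set.range fun a => column X (p a)) := by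
  let W : ℕ → Submodule ℝ (EuclideanSpace ℝ (Fin m)) := fun i =>
    Submodule.span ℝ ((fun a => column X (p a)) '' {a | (a : ℕ) < i})
  have hW : ∀ i, W i ≤ Submodule.span ℝ (Set.range fun a => column X (p a)) := fun i =>
    Submodule.span_mono (Set.image_subset_range _ _)
  have hz : ∀ i x, (W i)ᗮ.starProjection x = 0 ↔ x ∈ W i := fun i x => by
    rw [Submodule.starProjection_apply_eq_zero_iff, Submodule.orthogonal_orthogonal]
  by_cases h : ∃ i : Fin m, column X (p i) ∈ W i
  · obtain ⟨i, hi⟩ := h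
    have h1 := hp.2 i j
    change ‖(W i)ᗮ.starProjection (column X j)‖ ≤ ‖(W i)ᗮ.starProjection (column X (p i))‖ at h1
    rw [(hz _ _).2 hi, norm_zero, norm_le_zero_iff, hz] at h1
    exact hW i h1
  · push Not at h
    have hdim : ∀ i ≤ m, i ≤ Module.finrank ℝ (W i) := by
      intro i
      induction i with
      | zero => intro _; exact Nat.zero_le _
      | succ i ih =>
        intro hi
        refine Nat.succ_le_of_lt ((ih (by omega)).trans_lt (Submodule.finrank_lt_finrank_of_lt ?_))
        refine lt_of_le_of_ne (Submodule.span_mono (Set.image_mono fun a (ha : (a : ℕ) < i) =>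
          (show (a : ℕ) < i + 1 by omega))) fun he => h ⟨i, hi⟩ ?_
        change column X (p ⟨i, hi⟩) ∈ W i
        rw [he]
        exact Submodule.subset_span ⟨⟨i, hi⟩, Nat.lt_succ_self i, rfl⟩
    have htop : W m = ⊤ := Submodule.eq_top_of_finrank_eq (le_antisymm (Submodule.finrank_le _)
      (by simpa using hdim m le_rfl))
    exact hW m (htop ▸ Submodule.mem_top)

/-- A vector orthogonal to the pivots is orthogonal to all columns, hence zero because X has
independent rows. -/
theorem IsCPQR.det_gram_pos {p : Fin m → Fin n} (hp : IsCPQR X p)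
    (hX : ∀ v, v ᵥ* X = 0 → v = 0) {S : Finset (Fin n)} (hS : ∀ i, p i ∈ S) :
    0 < (gram X S).det := by
  refine ColumnExchange.det_gram_pos fun v hv => hX v (funext fun j => ?_)
  have hle : Submodule.span ℝ (Set.range fun a => column X (p a)) ≤
      (Submodule.span ℝ {(WithLp.toLp 2 v : EuclideanSpace ℝ (Fin m))})ᗮ := by
    rw [Submodule.span_le]
    rintro _ ⟨a, rfl⟩
    rw [SetLike.mem_coe, Submodule.mem_orthogonal_singleton_iff_inner_right,
      EuclideanSpace.inner_eq_star_dotProduct]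
    rw [star_trivial]
    exact hv _ (hS a)
  have h := hle (hp.column_mem_span j)
  rw [Submodule.mem_orthogonal_singleton_iff_inner_right,
    EuclideanSpace.inner_eq_star_dotProduct] at h
  rw [star_trivial] at h
  rw [Pi.zero_apply, vecMul, dotProduct_comm]
  exact h

end Initialization

theorem foldl_range_induction {σ : Type*} (f : σ → ℕ → σ) (P : ℕ → σ → Prop) (a : σ) (N : ℕ)
    (h0 : P 0 a) (hs : ∀ i < N, ∀ a, P i a → P (i + 1) (f a i)) :
    P N ((List.range N).foldl f a) := by
  induction N with
  | zero => exact h0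
  | succ N ih =>
    rw [List.range_succ, List.foldl_append]
    exact hs N (Nat.lt_succ_self N) _ (ih fun i hi => hs i (hi.trans (Nat.lt_succ_self N)))

/-! ### Greedy removal and insertion -/

section Resize

variable {m n : ℕ} {X : Matrix (Fin m) (Fin n) ℝ}

theorem removeP_spec {st : SplitState ℝ m n} (h : st.Valid X) (e : Fin n ≃ Fin n)
    (hc : m < st.S.card) :
    ∃ r ∈ st.S, (∀ j ∈ st.S, cross X (of st.Y) r r ≤ cross X (of st.Y) j j) ∧
      (removeP X e st).eval.S = st.S.erase r ∧ (removeP X e st).eval.Valid X := by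
  unfold removeP
  rw [Prog.eval_bind]
  rcases argminP_spec st.l (scan e (· ∈ st.S)) with ⟨-, h2⟩ | ⟨r, hr, h1, hmin⟩
  · obtain ⟨j, hj⟩ := Finset.card_pos.1 ((Nat.zero_le m).trans_lt hc)
    exact absurd h2 (List.ne_nil_of_mem ((mem_scan (p := (· ∈ st.S))).2 hj))
  rw [h1]
  replace hr : r ∈ st.S := (mem_scan (p := (· ∈ st.S))).1 hr
  have hmin' : ∀ j ∈ st.S, cross X (of st.Y) r r ≤ cross X (of st.Y) j j := fun j hj => by
    rw [← h.lev, ← h.lev]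
    exact hmin j ((mem_scan (p := (· ∈ st.S))).2 hj)
  simp only [Prog.eval_bind, eval_constP, eval_applyP, eval_againstP, eval_subP, eval_plusSqP,
    eval_plusRankOneP, Int.cast_one, Prog.eval_pure]
  exact ⟨r, hr, hmin', rfl, h.plusSq hr ((h.lev r).trans_ne (h.inv.cross_self_lt_one hmin' hc).ne)⟩

theorem appendP_spec {st : SplitState ℝ m n} (h : st.Valid X) (e : Fin n ≃ Fin n)
    (hc : st.S.card < n) :
    ∃ s ∉ st.S, (∀ j ∉ st.S, cross X (of st.Y) j j ≤ cross X (of st.Y) s s) ∧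
      (appendP X e st).eval.S = insert s st.S ∧ (appendP X e st).eval.Valid X := by
  unfold appendP
  rw [Prog.eval_bind]
  rcases argmaxP_spec st.l (scan e (· ∉ st.S)) with ⟨-, h2⟩ | ⟨s, hs, h1, hmax⟩
  · obtain ⟨j, hj⟩ : ∃ j, j ∉ st.S := by
      by_contra! hall
      rw [Finset.eq_univ_iff_forall.2 hall] at hc
      simp at hc
    exact absurd h2 (List.ne_nil_of_mem ((mem_scan (p := (· ∉ st.S))).2 hj))
  rw [h1]
  replace hs : s ∉ st.S := (mem_scan (p := (· ∉ st.S))).1 hs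
  have hmax' : ∀ j ∉ st.S, cross X (of st.Y) j j ≤ cross X (of st.Y) s s := fun j hj => by
    rw [← h.lev, ← h.lev]
    exact hmax j ((mem_scan (p := (· ∉ st.S))).2 hj)
  simp only [Prog.eval_bind, eval_constP, eval_applyP, eval_againstP, eval_addP, eval_lessSqP,
    eval_lessRankOneP, Int.cast_one, Prog.eval_pure]
  exact ⟨s, hs, hmax', rfl, h.lessSq hs⟩

theorem resizeP_remove {S : Finset (Fin n)} (hS : 0 < (gram X S).det) {k : ℕ} (hmk : m ≤ k)
    (hk : k ≤ S.card) (e : ℕ → (Fin n ≃ Fin n)) :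
    (resizeP X k e S).eval.card = k ∧ 0 < (gram X (resizeP X k e S).eval).det ∧
      (gram X S).det * k.choose m ≤ (gram X (resizeP X k e S).eval).det * S.card.choose m := by
  have heval : (resizeP X k e S).eval = ((List.range (S.card - k)).foldl
      (fun st i => (removeP X (e i) st).eval) (splitInit X S).eval).S := by
    simp only [resizeP, if_pos hk, Prog.eval_bind, Prog.eval_pure, Prog.eval_foldlM]
  have key := foldl_range_induction (fun st i => (removeP X (e i) st).eval)
    (fun i st => st.Valid X ∧ st.S.card + i = S.card ∧
      (gram X S).det * st.S.card.choose m ≤ (gram X st.S).det * S.card.choose m)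
    (splitInit X S).eval (S.card - k)
    ⟨splitInit_valid hS, by rw [splitInit_S]; rfl, by rw [splitInit_S]⟩ ?_
  · rw [heval]
    obtain ⟨h1, h2, h3⟩ := key
    have h4 : _ = k := Nat.add_right_cancel (h2.trans (Nat.add_sub_cancel' hk).symm)
    rw [h4] at h3
    exact ⟨h4, h1.inv.det_pos, h3⟩
  · rintro i hi st ⟨h1, h2, h3⟩
    obtain ⟨r, hr, hmin, hrS, hv⟩ := removeP_spec h1 (e i) (by omega)
    have hcard : (removeP X (e i) st).eval.S.card + 1 = st.S.card := by
      rw [hrS, Finset.card_erase_add_one hr]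
    refine ⟨hv, by omega, ?_⟩
    have h5 := h1.inv.det_mul_choose_le hr hmin hcard.symm (by omega)
    rw [← hrS, hcard] at h5
    have hc0 : (0 : ℝ) < st.S.card.choose m := by exact_mod_cast Nat.choose_pos (by omega)
    refine le_of_mul_le_mul_right ?_ hc0
    calc _ = (gram X S).det * st.S.card.choose m * (removeP X (e i) st).eval.S.card.choose m := by
          ring
      _ ≤ (gram X st.S).det * S.card.choose m * (removeP X (e i) st).eval.S.card.choose m := by
          gcongr
      _ = (gram X st.S).det * (removeP X (e i) st).eval.S.card.choose m * S.card.choose m := by ring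
      _ ≤ _ := by
          refine (mul_le_mul_of_nonneg_right h5 (Nat.cast_nonneg _)).trans_eq ?_
          ring

/-- The loop invariant carries the factor (|S|/(6k))^m for the current S. The hypothesis on U is its
initial case; at |S| = k the factor becomes (1/6)^m. -/
theorem resizeP_append {S : Finset (Fin n)} (hS : 0 < (gram X S).det) {k : ℕ} (hm : 1 ≤ m)
    (hmS : m ≤ S.card) (hk : S.card < k) (hkn : k ≤ n) (e : ℕ → (Fin n ≃ Fin n)) :
    (resizeP X k e S).eval.card = k ∧ 0 < (gram X (resizeP X k e S).eval).det ∧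
      ∀ U : Finset (Fin n), U.card = k →
        ((S.card : ℝ) / (6 * k)) ^ m * (gram X U).det ≤ (gram X S).det →
        (1 / 6 : ℝ) ^ m * (gram X U).det ≤ (gram X (resizeP X k e S).eval).det := by
  have heval : (resizeP X k e S).eval = ((List.range (k - S.card)).foldl
      (fun st i => (appendP X (e i) st).eval) (splitInit X S).eval).S := by
    simp only [resizeP, if_neg hk.not_ge, Prog.eval_bind, Prog.eval_pure, Prog.eval_foldlM]
  have key := foldl_range_induction (fun st i => (appendP X (e i) st).eval)
    (fun i st => st.Valid X ∧ st.S.card = S.card + i ∧ ∀ U : Finset (Fin n), U.card = k →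
      ((S.card : ℝ) / (6 * k)) ^ m * (gram X U).det ≤ (gram X S).det →
      ((st.S.card : ℝ) / (6 * k)) ^ m * (gram X U).det ≤ (gram X st.S).det)
    (splitInit X S).eval (k - S.card)
    ⟨splitInit_valid hS, by rw [splitInit_S]; rfl, fun U _ h => by rwa [splitInit_S]⟩ ?_
  · rw [heval]
    obtain ⟨h1, h2, h3⟩ := key
    have h4 := h2.trans (Nat.add_sub_cancel' hk.le)
    refine ⟨h4, h1.inv.det_pos, fun U hU h => ?_⟩
    have h5 := h3 U hU h
    have hk0 : (k : ℝ) ≠ 0 := by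
      have : 0 < k := by omega
      positivity
    rwa [h4, show (k : ℝ) / (6 * k) = 1 / 6 by field_simp] at h5
  · rintro i hi st ⟨h1, h2, h3⟩
    obtain ⟨s, hs, hmax, hsS, hv⟩ := appendP_spec h1 (e i) (by omega)
    have hcard : (appendP X (e i) st).eval.S.card = st.S.card + 1 := by
      rw [hsS, Finset.card_insert_of_notMem hs]
    refine ⟨hv, by omega, fun U hU h => ?_⟩
    have h5 := h1.inv.det_insert_ge (T := U) hs hmax hm (by omega) (by omega) (by
      rw [hU]; exact h3 U hU h)
    rwa [hU, ← hsS, ← hcard] at h5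

end Resize

/-! ### Quality of the advanced initialization -/

section Initialization

variable {m n : ℕ} {X : Matrix (Fin m) (Fin n) ℝ}

theorem advParam_sq_le {m : ℕ} (hm : 1 ≤ m) :
    advParam m ^ 2 ≤ 1 + 2 * (m : ℝ) / (2 * (m : ℝ) - 1) := by
  have hm' : (1 : ℝ) ≤ m := by exact_mod_cast hm
  rw [advParam, Real.sq_sqrt]
  · exact min_le_right _ _
  · refine le_min (Real.exp_pos _).le (add_nonneg one_pos.le (div_nonneg ?_ ?_)) <;> linarith

/-- If all columns are selected, the leverages are at most 1; the empty set is excluded by its size.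
A regular stop leaves a column outside S, which forces |S| = 2m - 1. -/
theorem SplitStop.cross_self_le_three {st : SplitState ℝ m n} {c : ℝ} (h : SplitStop X c st)
    (hst : st.Valid X) (hm : 1 ≤ m) (hn : 1 ≤ n) (hS : st.S.card = min (2 * m - 1) n)
    (hc : c ^ 2 ≤ 1 + 2 * (m : ℝ) / (2 * (m : ℝ) - 1)) (j : Fin n) :
    cross X (of st.Y) j j ≤ 3 := by
  rcases h with h | h | ⟨s, hs, r, l', hmax, hl', hmin, hexit⟩
  · have := hst.inv.cross_self_le_one (h ▸ Finset.mem_univ j)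
    linarith
  · rw [h, Finset.card_empty] at hS
    omega
  · have hlt : st.S.card < n := by
      have := Finset.card_lt_univ_of_notMem hs
      simpa using this
    exact hst.inv.cross_self_le_three hs hmax hl' hmin hm (by omega) (hexit.trans hc) j

theorem AdvancedInit.spec {k : ℕ} {S : Finset (Fin n)} (h : AdvancedInit X k S) (hm : 1 ≤ m)
    (hmk : m ≤ k) (hkn : k ≤ n) (hX : X.rank = m) :
    S.card = k ∧ 0 < (gram X S).det ∧
    (k ≤ 2 * m - 1 → ∀ U : Finset (Fin n), U.card = k →
      (gram X U).det ≤ 3 ^ m * (2 * m - 1).choose m * (gram X S).det) ∧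
    (2 * m - 1 ≤ k → ∀ U : Finset (Fin n), U.card = k →
      (gram X U).det ≤ 6 ^ m * (gram X S).det) := by
  obtain ⟨p, S₀, S₁, lq, ties, T, e, hp, hpS, hS₀, ⟨t, hl, -⟩, rfl⟩ := h
  have hX' := vecMul_eq_zero_of_rank_eq hX
  obtain ⟨A, hA, h1, h2, h3⟩ := exists_splitStart_eval lq hX' (hp.det_gram_pos hX' hpS)
  rw [h1] at hl
  obtain ⟨st, hst, rfl, hcard, hexit⟩ := splitLoop_spec hl h2
  rw [h3, hS₀] at hcard
  have hA2 : 0 < A.det ^ 2 := by positivity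
  have hapx : ∀ U : Finset (Fin n), (gram X U).det ≤ (3 * U.card / m) ^ m * (gram X st.S).det := by
    intro U
    have h4 := hst.inv.det_gram_le_of_cross_self_le hm
      (hexit.cross_self_le_three hst hm (by omega) hcard (advParam_sq_le hm)) U
    -- The stopping information concerns the preprocessed matrix; the common factor det A² cancels.
    rw [det_gram_mul_left, det_gram_mul_left, mul_left_comm] at h4
    exact le_of_mul_le_mul_left h4 hA2
  have hpos : 0 < (gram X st.S).det := by
    have := hst.inv.det_pos
    rw [det_gram_mul_left] at this
    exact pos_of_mul_pos_right this hA2.le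
  generalize st.S = S₁ at *
  have hm' : (0 : ℝ) < m := by exact_mod_cast hm
  rcases le_or_gt k S₁.card with hk | hk
  · obtain ⟨h5, h6, h7⟩ := resizeP_remove hpos hmk hk e
    refine ⟨h5, h6, fun hk' U hU => ?_, fun hk' U hU => ?_⟩
    -- Passing to m columns of U makes the factor (3|J|/m)^m equal to 3^m and produces C(k,m), which
    -- cancels against the loss of the removals.
    · obtain ⟨J, -, hJ, hle⟩ := exists_det_gram_le_choose X U (k - m) (by omega)
      have h8 := hapx J
      rw [hJ, mul_div_assoc, div_self hm'.ne', mul_one] at h8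
      rw [hU] at hle
      -- An inequality and not an equality, because |S₁| = n if n < 2m - 1.
      have h9 : (S₁.card.choose m : ℝ) ≤ (2 * m - 1).choose m := by
        exact_mod_cast Nat.choose_le_choose m (by omega)
      calc (gram X U).det ≤ k.choose m * (3 ^ m * (gram X S₁).det) := by
            refine hle.trans ?_
            gcongr
        _ = 3 ^ m * ((gram X S₁).det * k.choose m) := by ring
        _ ≤ 3 ^ m * ((gram X (resizeP X k e S₁).eval).det * (2 * m - 1).choose m) := by
            refine mul_le_mul_of_nonneg_left (h7.trans ?_) (by positivity)
            gcongr
        _ = _ := by ring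
    · have hk1 : S₁.card = k := by omega
      rw [hk1] at h7
      have hc0 : (0 : ℝ) < k.choose m := by exact_mod_cast Nat.choose_pos hmk
      refine (hapx U).trans ?_
      have h8 := le_of_mul_le_mul_right h7 hc0
      have h9 : 3 * (U.card : ℝ) / m ≤ 6 := by
        rw [div_le_iff₀ hm']
        have : U.card ≤ 2 * m := by omega
        have : (U.card : ℝ) ≤ 2 * m := by exact_mod_cast this
        linarith
      gcongr
  · have hS₁ : S₁.card = 2 * m - 1 := by omega
    obtain ⟨h5, h6, h7⟩ := resizeP_append hpos hm (by omega) hk hkn e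
    refine ⟨h5, h6, fun hk' => absurd hk' (by omega), fun hk' U hU => ?_⟩
    have hk0 : (0 : ℝ) < k := by exact_mod_cast hm.trans hmk
    -- Start of the insertion phase: the factor m/(3k) = 2m/(6k) from the stopping bound exceeds the
    -- required (2m-1)/(6k).
    have h8 := h7 U hU (by
      have h9 := hapx U
      rw [hU] at h9
      calc ((S₁.card : ℝ) / (6 * k)) ^ m * (gram X U).det
          ≤ ((m : ℝ) / (3 * k)) ^ m * ((3 * k / m) ^ m * (gram X S₁).det) := by
            have h10 : (S₁.card : ℝ) / (6 * k) ≤ m / (3 * k) := by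
              rw [div_le_div_iff₀ (by positivity) (by positivity)]
              have : S₁.card ≤ 2 * m := by omega
              have : (S₁.card : ℝ) ≤ 2 * m := by exact_mod_cast this
              nlinarith
            exact mul_le_mul
              (pow_le_pow_left₀ (div_nonneg (Nat.cast_nonneg _) (by positivity)) h10 m) h9
              (gram_posSemidef X U).det_nonneg (pow_nonneg (by positivity) m)
        _ = (gram X S₁).det := by
            rw [← mul_assoc, ← mul_pow, show (m : ℝ) / (3 * k) * (3 * k / m) = 1 by field_simp,
              one_pow, one_mul])
    rw [one_div, inv_pow, inv_mul_le_iff₀ (by positivity)] at h8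
    exact h8

theorem vol_le_of_det_le {S U : Finset (Fin n)} {a R : ℝ} (hR : a ^ 2 * R ≤ 1)
    (h : (gram X U).det ≤ R * (gram X S).det) : a * vol X U ≤ vol X S := by
  rw [vol_eq_sqrt_det_gram, vol_eq_sqrt_det_gram]
  refine Real.le_sqrt_of_sq_le ?_
  rw [mul_pow, Real.sq_sqrt (gram_posSemidef X U).det_nonneg]
  have h0 := (gram_posSemidef X S).det_nonneg
  calc a ^ 2 * (gram X U).det ≤ a ^ 2 * (R * (gram X S).det) := by gcongr
    _ = a ^ 2 * R * (gram X S).det := by ring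
    _ ≤ _ := mul_le_of_le_one_left h0 hR

end Initialization

/-! ### The Dominant algorithm -/

section Dominant

variable {m n : ℕ} {X : Matrix (Fin m) (Fin n) ℝ}

/-- This is Y (X_S X_Sᵀ) Y = Y, and it lets the algorithm recover x_sᵀ Y x_j from the stored rows i
∈ S although s ∉ S. -/
theorem IsGramInv.sum_cross_mul_cross {S : Finset (Fin n)} {Y : Matrix (Fin m) (Fin m) ℝ}
    (h : IsGramInv X S Y) (a b : Fin n) :
    ∑ i ∈ S, cross X Y i a * cross X Y i b = cross X Y a b := by
  have h1 : gram X S *ᵥ (Y *ᵥ Xᵀ b) = Xᵀ b := by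
    rw [mulVec_mulVec, mul_eq_one_comm.1 h, one_mulVec]
  have h2 : ∑ i ∈ S, cross X Y i a * cross X Y i b
      = (Y *ᵥ Xᵀ a) ⬝ᵥ (gram X S *ᵥ (Y *ᵥ Xᵀ b)) := by
    rw [gram, sum_mulVec, dotProduct_sum]
    refine Finset.sum_congr rfl fun i _ => ?_
    rw [vecMulVec_mulVec]
    simp [cross, dotProduct_comm, mul_comm]
  rw [h2, h1, dotProduct_mulVec_eq_cross, cross_comm X h.symm]

/-- The data of a state belong to its set of columns. -/
def DominantState.Valid (X : Matrix (Fin m) (Fin n) ℝ) (st : DominantState ℝ n) : Prop :=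
  ∃ Y, IsGramInv X st.S Y ∧ (∀ i ∈ st.S, ∀ j, st.C i j = cross X Y i j) ∧
    ∀ j, st.l j = cross X Y j j

theorem dominantInit_S (X : Matrix (Fin m) (Fin n) ℝ) (S : Finset (Fin n)) :
    (dominantInit X S).eval.S = S := by
  simp [dominantInit]

theorem dominantInit_valid {S : Finset (Fin n)} (h : 0 < (gram X S).det) :
    (dominantInit X S).eval.Valid X := by
  refine ⟨of (gramInverseP X S).eval, ?_, fun i hi j => ?_, fun j => ?_⟩
  · rw [dominantInit_S]
    exact isGramInv_gramInverseP h
  · rw [dominantInit_S] at hi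
    simp only [dominantInit, Prog.eval_bind, Prog.eval_pure, eval_tabulate, eval_applyP, if_pos hi,
      eval_dotP]
    rfl
  · simp only [dominantInit, Prog.eval_bind, Prog.eval_pure, eval_tabulate, eval_applyP, eval_dotP]
    rfl

theorem cost_dominantInit (X : Matrix (Fin m) (Fin n) ℝ) {S : Finset (Fin n)} (hm : 1 ≤ m)
    (hS : m ≤ S.card) : (dominantInit X S).cost ≤ 21 * (n * S.card * m) := by
  have hn : S.card ≤ n := by simpa using S.card_le_univ
  have h1 := cost_gramInverseP X hm hS
  simp only [dominantInit, Prog.cost_bind, Prog.cost_pure, cost_constP, add_zero]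
  refine (add_le_add h1 (add_le_add (cost_tabulate_le fun j => cost_applyP _ _ _)
    (add_le_add (le_refl 1) (add_le_add (cost_tabulate_le_card (B := n * (1 + 2 * m)) S
      (fun i hi => ?_) (fun i hi => ?_)) (cost_tabulate_le fun j => cost_dotP _ _))))).trans ?_
  · rw [if_pos hi]
    exact cost_tabulate_le fun j => cost_dotP _ _
  · rw [if_neg hi, Prog.cost_pure]
  · generalize S.card = q at *
    have a1 : m * m * q ≤ n * q * m := by
      calc m * m * q = m * q * m := by ring
        _ ≤ n * q * m := by gcongr; omega
    have a2 : n * (m * m) ≤ n * q * m := by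
      calc n * (m * m) = n * m * m := by ring
        _ ≤ n * q * m := by gcongr
    have a3 : n * m ≤ n * q * m := by
      calc n * m = n * 1 * m := by ring
        _ ≤ n * q * m := by gcongr; omega
    have a4 : n * q ≤ n * q * m := Nat.le_mul_of_pos_right _ hm
    have a5 : n ≤ n * m := Nat.le_mul_of_pos_right _ hm
    have a6 : 1 ≤ n := by omega
    nlinarith

/-- Only the gain of the chosen exchange enters; its maximality plays no role in the operation
count. -/
theorem dominantBody_spec {st : DominantState ℝ n} (h : st.Valid X) (c : ℝ)
    (e : Fin (n * n) ≃ Fin n × Fin n) :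
    (dominantBody c e st).eval = Sum.inr st.S ∨
    ∃ st', (dominantBody c e st).eval = Sum.inl st' ∧ st'.Valid X ∧
      st'.S.card = st.S.card ∧ (gram X st.S).det * c ^ 2 ≤ (gram X st'.S).det := by
  obtain ⟨Y, hY, hC, hl⟩ := h
  unfold dominantBody
  rw [Prog.eval_bind, Prog.eval_bind, eval_constP, Int.cast_one]
  generalize hB : (tabulate n _ : Prog ℝ (Fin n → Fin n → ℝ)).eval = B
  rw [Prog.eval_bind]
  rcases argmaxP_spec (fun p : Fin n × Fin n => B p.1 p.2)
      (scan e fun p => p.1 ∈ st.S ∧ p.2 ∉ st.S) with ⟨h1, -⟩ | ⟨⟨r, s⟩, hrs, h1, -⟩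
  · left
    rw [h1]
    rfl
  rw [h1]
  obtain ⟨hr, hs⟩ := (mem_scan (p := fun p : Fin n × Fin n => p.1 ∈ st.S ∧ p.2 ∉ st.S)).1 hrs
  replace hr : r ∈ st.S := hr
  replace hs : s ∉ st.S := hs
  have hBrs : B r s = (1 + st.l s) * (1 - st.l r) + st.C r s * st.C r s := by
    rw [← hB]
    simp [hr]
  simp only [Prog.eval_bind, ↓Prog.eval_ite, eval_mulP, eval_leP, hBrs]
  by_cases hc : (1 + st.l s) * (1 - st.l r) + st.C r s * st.C r s ≤ c * c
  · left
    rw [decide_eq_true hc, cond_true]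
    rfl
  right
  rw [decide_eq_false hc, cond_false]
  simp only [Prog.eval_bind, Prog.eval_pure, eval_addP, eval_subP, eval_tabulate, eval_divP,
    eval_mulP, eval_sumP_filter, eval_lessSqP, eval_plusSqP]
  have hu : ∀ j, ∑ i ∈ st.S, st.C i s * st.C i j = cross X Y s j := fun j => by
    rw [← hY.sum_cross_mul_cross]
    exact Finset.sum_congr rfl fun i hi => by rw [hC i hi, hC i hi]
  simp only [hu]
  have h0 := hY.cross_self_nonneg s
  have hd : 0 < 1 + cross X Y s s := by linarith
  have hY' := hY.insert_col hs
  have hx : ∀ i j, cross X (Y - (1 / (1 + cross X Y s s)) • vecMulVec (Y *ᵥ Xᵀ s) (Y *ᵥ Xᵀ s)) i j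
      = cross X Y i j - cross X Y s i * cross X Y s j / (1 + cross X Y s s) := fun i j => by
    rw [sub_eq_add_neg, ← neg_smul, IsGramInv.cross_rankOne hY.symm]; ring
  generalize Y - (1 / (1 + cross X Y s s)) • vecMulVec (Y *ᵥ Xᵀ s) (Y *ᵥ Xᵀ s) = Y' at *
  have hx' : ∀ i ∈ st.S, ∀ j, st.C i j - st.C i s * (cross X Y s j / (1 + st.l s))
      = cross X Y' i j := fun i hi j => by
    rw [hx, hC i hi, hC i hi, hl, cross_comm X hY.symm s i, mul_div_assoc]
  have hxs : ∀ j, cross X Y s j / (1 + st.l s) = cross X Y' s j := fun j => by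
    rw [hx, hl]
    field_simp
    ring
  have hl' : ∀ j, st.l j - cross X Y s j * cross X Y s j / (1 + st.l s) = cross X Y' j j :=
    fun j => by rw [hx, hl, hl]
  simp only [hx' r hr, hl']
  have hmem : r ∈ insert s st.S := Finset.mem_insert_of_mem hr
  -- Identifies the tabulated ratio with the product of the insertion factor and the erasure factor.
  have hgain : (1 + cross X Y s s) * (1 - cross X Y' r r)
      = (1 + st.l s) * (1 - st.l r) + st.C r s * st.C r s := by
    rw [hx, hl, hl, hC r hr, cross_comm X hY.symm s r]
    field_simp
    ring
  have hone : cross X Y' r r ≠ 1 := fun h1 => by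
    rw [← hgain, h1, sub_self, mul_zero] at hc
    exact hc (mul_self_nonneg c)
  have hY'' := hY'.erase_col hmem hone
  have hxx := IsGramInv.cross_rankOne (X := X) hY'.symm (1 / (1 - cross X Y' r r)) r
  refine ⟨_, rfl, ⟨_, hY'', fun i hi j => ?_, fun j => ?_⟩, ?_, ?_⟩
  · simp only at hi ⊢
    rw [if_pos hi, Prog.eval_bind, eval_tabulate, hxx]
    obtain ⟨hir, hi⟩ := Finset.mem_erase.1 hi
    by_cases his : i = s
    · subst his
      simp only [if_pos, Prog.eval_bind, Prog.eval_pure, eval_mulP, eval_divP, eval_addP, hxs]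
      ring
    · have hiS := Finset.mem_of_mem_insert_of_ne hi his
      simp only [if_neg his, Prog.eval_bind, eval_mulP, eval_divP, eval_subP, eval_addP,
        hx' i hiS]
      ring
  · simp only
    rw [hxx]
    ring
  · simp [Finset.card_erase_of_mem hmem, hs]
  · simp only
    rw [hY'.det_gram_erase hmem, hY.det_gram_insert hs, mul_assoc, hgain, sq]
    exact mul_le_mul_of_nonneg_left (not_le.1 hc).le hY.det_pos.le

theorem cost_dominantBody (c : ℝ) (e : Fin (n * n) ≃ Fin n × Fin n) (st : DominantState ℝ n)
    (hS : 1 ≤ st.S.card) : (dominantBody c e st).cost ≤ 40 * (n * st.S.card) := by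
  have hn : st.S.card ≤ n := by simpa using st.S.card_le_univ
  unfold dominantBody
  rw [Prog.cost_bind, Prog.cost_bind]
  have hB : ∀ one : ℝ, (tabulate n fun r => if r ∈ st.S then tabulate n fun s => do
      let a ← addP one (st.l s)
      let b ← subP one (st.l r)
      let ab ← mulP a b
      let q ← mulP (st.C r s) (st.C r s)
      addP ab q
    else pure (st.C r)).cost ≤ st.S.card * (n * 5) := fun one => by
    refine cost_tabulate_le_card st.S (fun r hr => ?_) fun r hr => by rw [if_neg hr, Prog.cost_pure]
    rw [if_pos hr]
    exact cost_tabulate_le fun s => by simp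
  generalize (tabulate n _ : Prog ℝ (Fin n → Fin n → ℝ)).eval = B
  have hscan := (cost_argmaxP_le (fun p : Fin n × Fin n => B p.1 p.2) _).trans
    (length_scan_le_card e (fun p => p.1 ∈ st.S ∧ p.2 ∉ st.S) (st.S ×ˢ Finset.univ)
      fun p hp => by simp [hp.1])
  rw [Finset.card_product, Finset.card_univ, Fintype.card_fin] at hscan
  have a1 : n ≤ n * st.S.card := Nat.le_mul_of_pos_right _ hS
  have a2 : 1 ≤ n := hS.trans hn
  have a3 : st.S.card * (n * 5) = 5 * (n * st.S.card) := by ring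
  rw [mul_comm st.S.card n] at hscan
  refine (add_le_add (le_refl 1) (add_le_add ((hB _).trans_eq a3) ((Prog.cost_bind _ _).trans_le
    (add_le_add hscan (?_ : _ ≤ 31 * (n * st.S.card)))))).trans (by omega)
  rcases (argmaxP (fun p : Fin n × Fin n => B p.1 p.2) _).eval with _ | ⟨r, s⟩
  · simp
  simp only [Prog.cost_bind]
  have hcard : ((insert s st.S).erase r).card ≤ st.S.card + 1 :=
    (Finset.card_le_card (Finset.erase_subset _ _)).trans (Finset.card_insert_le _ _)
  -- The crude bound |S| + 1 suffices, since |S| + 1 ≤ 2|S| and 1 + 4n ≤ 5n.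
  have a4 : ((insert s st.S).erase r).card * (1 + n * 4) ≤ 10 * (n * st.S.card) := by
    refine (Nat.mul_le_mul_right _ hcard).trans ?_
    nlinarith
  have a5 : n * (1 + st.S.card * (1 + 1)) = n + 2 * (n * st.S.card) := by ring
  refine (add_le_add (le_refl 1) (add_le_add (le_refl 1) (Prog.cost_ite_le _
    (B := 27 * (n * st.S.card)) (by simp) ?_))).trans (by omega)
  simp only [Prog.cost_bind, Prog.cost_pure]
  refine (add_le_add ((cost_tabulate_le fun j => cost_sumP_le _ (B := 1) (by simp)).trans_eq
    (by rw [length_filter_finRange, a5])) (add_le_add (cost_addP _ _).le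
    (add_le_add (cost_tabulate_le (B := 1) fun j => by simp) (add_le_add (cost_lessSqP _ _ _)
    (add_le_add (cost_subP _ _).le (add_le_add (cost_tabulate_le (B := 2) fun j => by simp)
    (add_le_add (cost_plusSqP _ _ _) (add_le_add ((cost_tabulate_le_card (B := 1 + n * 4)
      ((insert s st.S).erase r) (fun i hi => ?_) (fun i hi => ?_)).trans a4)
      (le_refl 0))))))))).trans (by omega)
  · rw [if_pos hi, Prog.cost_bind]
    refine add_le_add (cost_divP _ _).le (cost_tabulate_le fun j => ?_)
    split_ifs <;> simp
  · rw [if_neg hi, Prog.cost_pure]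

theorem exists_dominant (ties : ℕ → (Fin (n * n) ≃ Fin n × Fin n)) {S : Finset (Fin n)}
    (hS : 0 < (gram X S).det) (hm : 1 ≤ m) (hmS : m ≤ S.card) {c R : ℝ}
    (hR : ∀ T : Finset (Fin n), T.card = S.card → (gram X T).det ≤ R * (gram X S).det)
    {N : ℕ} (hN : R < (c ^ 2) ^ (N + 1)) :
    ∃ (S' : Finset (Fin n)) (T : ℕ), Dominant ties X c S S' T ∧
      T ≤ 21 * (n * S.card * m) + (N + 1) * (40 * (n * S.card)) := by
  obtain ⟨S', t, hl, ht⟩ := Loop.exists_of_potential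
    (body := fun i => dominantBody c (ties i))
    (fun st => st.Valid X ∧ st.S.card = S.card) (fun st => (gram X st.S).det)
    (M := R * (gram X S).det) (q := c ^ 2) (C := 40 * (n * S.card)) (sq_nonneg c)
    (fun st hst => hR _ hst.2)
    (fun i st hst => by
      rw [← hst.2]
      exact cost_dominantBody _ _ _ (by omega))
    (fun i st st' hst h => by
      rcases dominantBody_spec hst.1 c (ties i) with h1 | ⟨st₁, h1, h4, h5, h6⟩
      · exact absurd (h1.symm.trans h) (by simp)
      · obtain rfl := Sum.inl.inj (h1.symm.trans h)
        exact ⟨⟨h4, h5.trans hst.2⟩, h6⟩)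
    N 0 (dominantInit X S).eval ⟨dominantInit_valid hS, by rw [dominantInit_S]⟩ (by
      rw [dominantInit_S, mul_comm]
      exact mul_lt_mul_of_pos_left hN hS)
  exact ⟨S', _, ⟨t, hl, rfl⟩, add_le_add (cost_dominantInit X hm hmS) ht⟩

end Dominant

/-! ### Numerical bounds and assembly -/

theorem rpow_neg_half_sq {a : ℝ} (ha : 0 < a) (m : ℕ) :
    (a ^ (-(m : ℝ) / 2)) ^ 2 = (a ^ m)⁻¹ := by
  rw [← Real.rpow_natCast, ← Real.rpow_mul ha.le, Nat.cast_ofNat, div_mul_cancel₀ _ two_ne_zero,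
    Real.rpow_neg ha.le, Real.rpow_natCast]

/-- A bound for both ranges of k: C(2m-1,m) ≤ 4^m turns the first into 3^m 4^m, and the second is
only 6^m. -/
theorem AdvancedInit.det_gram_le {m n k : ℕ} {X : Matrix (Fin m) (Fin n) ℝ} {S : Finset (Fin n)}
    (h : AdvancedInit X k S) (hm : 1 ≤ m) (hmk : m ≤ k) (hkn : k ≤ n) (hX : X.rank = m)
    (U : Finset (Fin n)) (hU : U.card = k) :
    (gram X U).det ≤ 12 ^ m * (gram X S).det := by
  obtain ⟨-, hpos, h1, h2⟩ := h.spec hm hmk hkn hX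
  rcases le_total k (2 * m - 1) with hk | hk
  · refine (h1 hk U hU).trans ?_
    have h3 : ((2 * m - 1).choose m : ℝ) ≤ 4 ^ m := by
      have := (Nat.choose_le_two_pow (2 * m - 1) m).trans
        (Nat.pow_le_pow_right two_pos (Nat.sub_le (2 * m) 1))
      rw [pow_mul] at this
      exact_mod_cast this
    calc (3 : ℝ) ^ m * (2 * m - 1).choose m * (gram X S).det
        ≤ 3 ^ m * 4 ^ m * (gram X S).det := by gcongr
      _ = 12 ^ m * (gram X S).det := by rw [← mul_pow]; norm_num
  · refine (h2 hk U hU).trans ?_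
    gcongr
    norm_num

/-- On taking logarithms, 2(N+1) log c > 12m ≥ m log 12, where N is the floor of 6m / log c. -/
theorem twelve_pow_lt {c : ℝ} (hc : 1 < c) (m : ℕ) :
    (12 : ℝ) ^ m < (c ^ 2) ^ (⌊6 * m / Real.log c⌋₊ + 1) := by
  have hlog := Real.log_pos hc
  have hc0 : 0 < c := one_pos.trans hc
  have h12 : Real.log 12 ≤ 11 := by
    have := Real.log_le_sub_one_of_pos (show (0 : ℝ) < 12 by norm_num)
    linarith
  have h1 := Nat.lt_floor_add_one (6 * m / Real.log c)
  rw [div_lt_iff₀ hlog] at h1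
  rw [← Real.log_lt_log_iff (by positivity) (by positivity), Real.log_pow, Real.log_pow,
    Real.log_pow]
  push_cast
  have hm : (0 : ℝ) ≤ m := Nat.cast_nonneg m
  nlinarith

end ColumnExchange

theorem mainTheorem3 :
    ∃ K : ℝ, 0 < K ∧
      ∀ (m n k : ℕ) (X : Matrix (Fin m) (Fin n) ℝ) (S : Finset (Fin n)),
        1 ≤ m → m ≤ k → k ≤ n → X.rank = m →
        ColumnExchange.AdvancedInit X k S →
        (k ≤ 2 * m - 1 → ∀ U : Finset (Fin n), U.card = k →
          (3 : ℝ) ^ (-(m : ℝ) / 2) / Real.sqrt ((2 * m - 1).choose m) * ColumnExchange.vol X U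
            ≤ ColumnExchange.vol X S) ∧
        (2 * m - 1 ≤ k → ∀ U : Finset (Fin n), U.card = k →
          (6 : ℝ) ^ (-(m : ℝ) / 2) * ColumnExchange.vol X U ≤ ColumnExchange.vol X S) ∧
        ∀ c : ℝ, 1 < c →
          (∀ (lq : Bool) (ties : ColumnExchange.SplitTies n),
            ∃ (S' : Finset (Fin n)) (T : ℕ),
              ColumnExchange.DominantSplit lq ties X c S S' T ∧
              (T : ℝ) ≤ K * ((n : ℝ) * (m : ℝ) ^ 2 * (1 + 1 / Real.log c))) ∧
          (∀ ties : ℕ → (Fin (n * n) ≃ Fin n × Fin n),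
            ∃ (S' : Finset (Fin n)) (T : ℕ),
              ColumnExchange.Dominant ties X c S S' T ∧
              (T : ℝ) ≤ K * ((n : ℝ) * (k : ℝ) * (m : ℝ) * (1 + 1 / Real.log c))) := by
  -- The constant is 6·40, from 6m / log c exchanges at 40nk operations each; the other terms have
  -- smaller coefficients.
  refine ⟨240, by norm_num, fun m n k X S hm hmk hkn hX h => ?_⟩
  obtain ⟨hcard, hpos, h1, h2⟩ := h.spec hm hmk hkn hX
  refine ⟨fun hk U hU => ?_, fun hk U hU => ?_, fun c hc => ?_⟩
  · have hch : (0 : ℝ) < (2 * m - 1).choose m := by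
      exact_mod_cast Nat.choose_pos (by omega)
    refine ColumnExchange.vol_le_of_det_le ?_ (h1 hk U hU)
    rw [div_pow, Real.sq_sqrt hch.le, ColumnExchange.rpow_neg_half_sq three_pos]
    refine le_of_eq ?_
    field_simp
  · refine ColumnExchange.vol_le_of_det_le ?_ (h2 hk U hU)
    rw [ColumnExchange.rpow_neg_half_sq (by norm_num)]
    exact (inv_mul_cancel₀ (by positivity)).le
  · have hlog := Real.log_pos hc
    have hR : ∀ U : Finset (Fin n), U.card = S.card → _ := fun U hU =>
      h.det_gram_le hm hmk hkn hX U (hU.trans hcard)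
    have hN := ColumnExchange.twelve_pow_lt hc m
    have hfl : (⌊6 * (m : ℝ) / Real.log c⌋₊ : ℝ) ≤ 6 * m * (1 / Real.log c) :=
      (Nat.floor_le (by positivity)).trans_eq (by ring)
    have hm' : (1 : ℝ) ≤ m := by exact_mod_cast hm
    have hx : 0 < 1 / Real.log c := by positivity
    generalize (1 / Real.log c) = x at *
    refine ⟨fun lq ties => ?_, fun ties => ?_⟩
    · obtain ⟨S', T, hT, hle⟩ := ColumnExchange.exists_dominantSplit lq ties
        (ColumnExchange.vecMul_eq_zero_of_rank_eq hX) hpos hm (by omega) hR hN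
      refine ⟨S', T, hT, ?_⟩
      generalize ⌊6 * (m : ℝ) / Real.log c⌋₊ = N at *
      have hn : (0 : ℝ) ≤ n * m := by positivity
      calc (T : ℝ) ≤ 27 * (n * m ^ 2) + (N + 1) * (32 * (n * m)) := by exact_mod_cast hle
        -- The final pass, counted by the 1 in N + 1, is absorbed using 1 ≤ m.
        _ ≤ 27 * (n * m ^ 2) + (6 * m * x + m) * (32 * (n * m)) := by gcongr
        _ = 59 * (n * m ^ 2) + 192 * (n * m ^ 2 * x) := by ring
        _ ≤ 240 * (n * m ^ 2) + 240 * (n * m ^ 2 * x) := by gcongr <;> norm_num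
        _ = _ := by ring
    · obtain ⟨S', T, hT, hle⟩ := ColumnExchange.exists_dominant ties hpos hm (by omega) hR hN
      refine ⟨S', T, hT, ?_⟩
      generalize ⌊6 * (m : ℝ) / Real.log c⌋₊ = N at *
      rw [hcard] at hle
      calc (T : ℝ) ≤ 21 * (n * k * m) + (N + 1) * (40 * (n * k)) := by exact_mod_cast hle
        _ ≤ 21 * (n * k * m) + (6 * m * x + m) * (40 * (n * k)) := by gcongr
        _ = 61 * (n * k * m) + 240 * (n * k * m * x) := by ring
        _ ≤ 240 * (n * k * m) + 240 * (n * k * m * x) := by gcongr; norm_num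
        _ = _ := by ring
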